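/- Theorem 3. Let $k,l\ge 1$, let $\sigma(t)=1/(1+e^{-t})$, and let $P_r$ and $P_Z$ be probability distributions on $\{x\in\mathbb R^d:\|x\|_2\le B_x\}$ and $\{z\in\mathbb R^p:\|z\|_2\le B_z\}$. Consider discriminators and generators $$D_\omega(x)=\sigma\big(\mathbf w_k^{\mathsf T} r_{k-1}(\mathbf W_{k-1}r_{k-2}(\cdots r_1(\mathbf W_1x)))\big),\qquad G_\theta(z)=\mathbf V_l s_{l-1}(\mathbf V_{l-1}s_{l-2}(\cdots s_1(\mathbf V_1z))),$$ where $r_i$ ($1\le i\le k-1$) and $s_j$ ($1\le j\le l-1$) are entrywise activations that are positively homogeneous ($r_i(\lambda p)=\lambda r_i(p)$, $s_j(\lambda p)=\lambda s_j(p)$ for $\lambda\ge0$, $p\in\mathbb R$) and $R_i$- respectively $S_j$-Lipschitz, and where $\omega=(\mathbf W_1,\dots,\mathbf W_{k-1},\mathbf w_k)$ ranges over a nonempty set $\Omega$ of parameters with $\|\mathbf W_i\|_F\le M_i$ ($1\le i\le k-1$), $\|\mathbf w_k\|_2\le M_k$, and $\theta=(\mathbf V_1,\dots,\mathbf V_l)$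 over a nonempty set $\Theta$ of parameters with $\|\mathbf V_j\|_F\le N_j$ ($1\le j\le l$). For a loss $\ell(y,\hat y)$, $y\in\{0,1\}$, put $\phi=-\ell(1,\cdot)$, $\psi=-\ell(0,\cdot)$ and, for distributions $P,Q$ on $\mathbb R^d$, $$d^{(\ell)}(P,Q)=\sup_{\omega\in\Omega}\big(\mathbb E_{X\sim P}\,\phi(D_\omega(X))+\mathbb E_{X\sim Q}\,\psi(D_\omega(X))\big).$$ Let $X_1,\dots,X_n$ be i.i.d. from $P_r$ and $Z_1,\dots,Z_m$ i.i.d. from $P_Z$ ($n,m\ge1$), let $\hat P_r$ and $\hat P_{G_\theta}$ be the empirical distributions of $(X_i)_{i\le n}$ and $(G_\theta(Z_j))_{j\le m}$, let $P_{G_\theta}$ be the law of $G_\theta(Z)$ for $Z\sim P_Z$, and let $\hat\theta^*$ denote a minimizer of $\theta\mapsto d^{(\ell)}(\hat P_r,\hat P_{G_\theta})$ over $\Theta$. Put $U_\omega=M_k\prod_{i=1}^{k-1}(M_iR_i)$, $U_\theta=N_l\prod_{j=1}^{l-1}(N_jS_j)$, and let $0<\delta<1$. (a) If $\phi$ and $\psi$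 are $L_\phi$- and $L_\psi$-Lipschitz on $[0,1]$, then with probability at least $1-2\delta$ over the samples, for every such $\hat\theta^*$, $$d^{(\ell)}(P_r,\hat P_{G_{\hat\theta^*}})-\inf_{\theta\in\Theta}d^{(\ell)}(P_r,P_{G_\theta})\le\frac{L_\phi B_xU_\omega\sqrt{3k}}{\sqrt n}+\frac{L_\psi U_\omega U_\theta B_z\sqrt{3(k+l-1)}}{\sqrt m}+U_\omega\sqrt{\log\tfrac1\delta}\left(\frac{L_\phi B_x}{\sqrt{2n}}+\frac{L_\psi B_zU_\theta}{\sqrt{2m}}\right),$$ and the same bound holds with $P_{G_{\hat\theta^*}}$ in place of $\hat P_{G_{\hat\theta^*}}$. (b) Let $\alpha\in(0,\infty)$ and let $\ell=\ell_\alpha$ be the $\alpha$-loss, $\ell_\alpha(y,\hat y)=\frac{\alpha}{\alpha-1}\big(1-y\hat y^{\frac{\alpha-1}{\alpha}}-(1-y)(1-\hat y)^{\frac{\alpha-1}{\alpha}}\big)$ for $\alpha\ne1$ and $\ell_1(y,\hat y)=-y\log\hat y-(1-y)\log(1-\hat y)$. Then the statement in (a) holds with $L_\phi$ replaced by $4C_{Q_x}(\alpha)$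 and $L_\psi$ replaced by $4C_{Q_z}(\alpha)$, where $Q_x=U_\omega B_x$, $Q_z=U_\omega U_\theta B_z$ and $$C_h(\alpha)=\begin{cases}\sigma(h)\,\sigma(-h)^{\frac{\alpha-1}{\alpha}},&\alpha\in(0,1],\\[2pt]\left(\frac{\alpha-1}{2\alpha-1}\right)^{\frac{\alpha-1}{\alpha}}\frac{\alpha}{2\alpha-1},&\alpha\in(1,\infty).\end{cases}$$ -/

import Mathlib

open MeasureTheory ProbabilityTheory
open scoped NNReal ENNReal Matrix

noncomputable section

/-- The hidden part `x ↦ a_j(W_j a_{j-1}(W_{j-1} … a_1(W_1 x)))` of a feed-forward network with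
`j` hidden layers. Layer `i` has width `e i` (`e 0` is the input dimension), the `i`-th activation
`a i` (`1 ≤ i ≤ j`) is applied entrywise, and the matrix of layer `i + 1` is `W i`. -/
def hiddenLayers (e : ℕ → ℕ) (a : ℕ → ℝ → ℝ) :
    (j : ℕ) → ((i : Fin j) → Matrix (Fin (e (i + 1))) (Fin (e i)) ℝ) →
      (Fin (e 0) → ℝ) → (Fin (e j) → ℝ)
  | 0, _, x => x
  | j + 1, W, x => fun t =>
      a (j + 1) ((W (Fin.last j) *ᵥ hiddenLayers e a j (fun i => W i.castSucc) x) t)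

/-- Parameters of a discriminator with `k` layers: the matrices `W_1, …, W_{k-1}` of the hidden
layers and the vector `w_k` of the output layer. -/
abbrev DiscParam (e : ℕ → ℕ) (k : ℕ) : Type :=
  ((i : Fin (k - 1)) → Matrix (Fin (e (i + 1))) (Fin (e i)) ℝ) × EuclideanSpace ℝ (Fin (e (k - 1)))

/-- Parameters of a generator with `l` layers and output dimension `d`: the matrices
`V_1, …, V_{l-1}` of the hidden layers and the matrix `V_l` of the output layer. -/
abbrev GenParam (q : ℕ → ℕ) (l d : ℕ) : Type :=
  ((j : Fin (l - 1)) → Matrix (Fin (q (j + 1))) (Fin (q j)) ℝ) × Matrix (Fin d) (Fin (q (l - 1))) ℝ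

/-- The discriminator `D_ω(x) = σ(w_kᵀ r_{k-1}(W_{k-1} r_{k-2}(… r_1(W_1 x))))`,
with `σ` the sigmoid function. -/
def discriminator (e : ℕ → ℕ) (r : ℕ → ℝ → ℝ) (k : ℕ) (ω : DiscParam e k)
    (x : EuclideanSpace ℝ (Fin (e 0))) : ℝ :=
  Real.sigmoid (∑ t, ω.2 t * hiddenLayers e r (k - 1) ω.1 x.ofLp t)

/-- The generator `G_θ(z) = V_l s_{l-1}(V_{l-1} s_{l-2}(… s_1(V_1 z)))`. -/
def generator (q : ℕ → ℕ) (s : ℕ → ℝ → ℝ) (l d : ℕ) (θ : GenParam q l d)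
    (z : EuclideanSpace ℝ (Fin (q 0))) : EuclideanSpace ℝ (Fin d) :=
  WithLp.toLp 2 (θ.2 *ᵥ hiddenLayers q s (l - 1) θ.1 z.ofLp)

open scoped Matrix.Norms.Frobenius in
/-- The discriminator parameters with `‖W_i‖_F ≤ M_i` for `1 ≤ i ≤ k - 1` and `‖w_k‖₂ ≤ M_k`. -/
def boundedDisc (e : ℕ → ℕ) (k : ℕ) (M : ℕ → ℝ≥0) : Set (DiscParam e k) :=
  {ω | (∀ i : Fin (k - 1), ‖ω.1 i‖ ≤ M (i + 1)) ∧ ‖ω.2‖ ≤ M k}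

open scoped Matrix.Norms.Frobenius in
/-- The generator parameters with `‖V_j‖_F ≤ N_j` for `1 ≤ j ≤ l`. -/
def boundedGen (q : ℕ → ℕ) (l d : ℕ) (N : ℕ → ℝ≥0) : Set (GenParam q l d) :=
  {θ | (∀ j : Fin (l - 1), ‖θ.1 j‖ ≤ N (j + 1)) ∧ ‖θ.2‖ ≤ N l}

/-- The capacity constant `A_h ∏_{i=1}^{h-1} (A_i T_i)` of a network with `h` layers whose `i`-th
weight matrix has norm at most `A i` and whose `i`-th activation is `T i`-Lipschitz. -/
def capacity (h : ℕ) (A T : ℕ → ℝ≥0) : ℝ :=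
  A h * ∏ i ∈ Finset.Icc 1 (h - 1), ((A i : ℝ) * T i)

/-- The empirical distribution of a finite sample. -/
def empirical {E : Type*} [MeasurableSpace E] {n : ℕ} (x : Fin n → E) : Measure E :=
  (n : ℝ≥0∞)⁻¹ • ∑ i, Measure.dirac (x i)

/-- The loss-inclusive neural-net distance
`sup_{ω ∈ Ω} (E_{X ∼ P} φ(D_ω(X)) + E_{X ∼ Q} ψ(D_ω(X)))` of a loss `ℓ(y, ŷ)`, `y ∈ {0, 1}`,
where `φ = -ℓ(1, ·)` and `ψ = -ℓ(0, ·)`. -/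
def nnDist (e : ℕ → ℕ) (r : ℕ → ℝ → ℝ) (k : ℕ) (Ω : Set (DiscParam e k))
    (ℓ : Fin 2 → ℝ → ℝ) (P Q : Measure (EuclideanSpace ℝ (Fin (e 0)))) : ℝ :=
  ⨆ ω : Ω, ((∫ x, -ℓ 1 (discriminator e r k ω x) ∂P) + ∫ x, -ℓ 0 (discriminator e r k ω x) ∂Q)

/-- The `α`-loss
`ℓ_α(y, ŷ) = α/(α-1) (1 - y ŷ^((α-1)/α) - (1-y) (1-ŷ)^((α-1)/α))` for `α ≠ 1`, extended
continuously to `α = 1` by the log-loss. -/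
def alphaLoss (α : ℝ) (y : Fin 2) (p : ℝ) : ℝ :=
  if α = 1 then
    -((y : ℕ) : ℝ) * Real.log p - (1 - ((y : ℕ) : ℝ)) * Real.log (1 - p)
  else
    α / (α - 1) * (1 - ((y : ℕ) : ℝ) * p ^ ((α - 1) / α)
      - (1 - ((y : ℕ) : ℝ)) * (1 - p) ^ ((α - 1) / α))

/-- The constant `C_h(α)`. At `α = 1` the first expression, the smaller of the two, is used. -/
def alphaLipConst (h α : ℝ) : ℝ :=
  if α ≤ 1 then Real.sigmoid h * Real.sigmoid (-h) ^ ((α - 1) / α)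
  else ((α - 1) / (2 * α - 1)) ^ ((α - 1) / α) * (α / (2 * α - 1))

/-- The right-hand side of the estimation error bound. -/
def errorBound (k l n m : ℕ) (Bx Bz Uω Uθ Lφ Lψ δ : ℝ) : ℝ :=
  Lφ * Bx * Uω * √(3 * k) / √n + Lψ * Uω * Uθ * Bz * √(3 * (k + l - 1)) / √m
    + Uω * √(Real.log (1 / δ)) * (Lφ * Bx / √(2 * n) + Lψ * Bz * Uθ / √(2 * m))

/-- With probability at least `1 - 2δ`, for every minimizer `θ'` over `Θ` of the empirical
objective `θ ↦ d(P̂_r, P̂_{G_θ})`, the estimation error `d(P_r, ·) - inf_{θ ∈ Θ} d(P_r, P_{G_θ})`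
is at most `b`, both at the empirical generated distribution `P̂_{G_θ'}` and at the generated
distribution `P_{G_θ'}` itself. -/
def EstimationErrorLE {S : Type*} [MeasurableSpace S] (μ : Measure S)
    {e q : ℕ → ℕ} (r s : ℕ → ℝ → ℝ) (k l n m : ℕ)
    (Ω : Set (DiscParam e k)) (Θ : Set (GenParam q l (e 0))) (ℓ : Fin 2 → ℝ → ℝ)
    (Pr : Measure (EuclideanSpace ℝ (Fin (e 0)))) (PZ : Measure (EuclideanSpace ℝ (Fin (q 0))))
    (X : Fin n → S → EuclideanSpace ℝ (Fin (e 0)))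
    (Z : Fin m → S → EuclideanSpace ℝ (Fin (q 0))) (δ b : ℝ) : Prop :=
  ∃ A : Set S, MeasurableSet A ∧ 1 - 2 * δ ≤ μ.real A ∧ ∀ a ∈ A, ∀ θ' ∈ Θ,
    IsMinOn (fun θ => nnDist e r k Ω ℓ (empirical fun i => X i a)
      (empirical fun j => generator q s l (e 0) θ (Z j a))) Θ θ' →
    nnDist e r k Ω ℓ Pr (empirical fun j => generator q s l (e 0) θ' (Z j a))
        - (⨅ θ : Θ, nnDist e r k Ω ℓ Pr (PZ.map (generator q s l (e 0) θ))) ≤ b ∧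
    nnDist e r k Ω ℓ Pr (PZ.map (generator q s l (e 0) θ'))
        - (⨅ θ : Θ, nnDist e r k Ω ℓ Pr (PZ.map (generator q s l (e 0) θ))) ≤ b

end

/-! Compose the losses with the sigmoid, so that they become functions of the logit. On the range
`[-Q, Q]` of the logits each is `K`-Lipschitz: `K = L / 4` in (a), since the sigmoid is
`1/4`-Lipschitz, and `K = C_Q(α)` in (b), a bound for the derivative of the composition. After
subtraction of the value at logit zero and clamping, it is globally `K`-Lipschitz, bounded by `K *
Q` and zero at zero.

For an empirical minimizer, the estimation error is bounded by differences of deviations (population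
mean minus sample mean) at two parameters, one difference for each sample
(`iSup_sub_iInf_iSup_le_of_minimizer`). These differences are treated as the deviations of a class
of their own, so McDiarmid's inequality is used once per sample. A union bound then gives `1 - 2δ`,
without independence between the two samples. The mean of the supremum is bounded by Rademacher sums
through symmetrization (`integral_iSup_sub_le`).

The Rademacher sums are bounded through exponential moments. By homogeneity, the norm of a signed
sum of layer outputs is at most the Frobenius norm times the absolute value of the same sum for one
unit with weight vector in the unit ball. Removing the absolute value costs a factor `2`;
contraction then removes the activation and leaves the norm of the signed sum one layer below
(`exists_sum_exp_norm_hiddenLayers_le`). At the bottom stands a signed sum of vectors in a Hilbert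
space, whose exponential moment is at most `2 * exp (c² B² n / 2)` on average. The total factor is
`2 ^ k`, or `2 ^ (k + l - 1)` with the generator; a logarithm and a choice of `c` turn it into
`√(3k)`, respectively `√(3(k + l - 1))`.

In these estimates a supremum over the class is replaced by an arbitrary selection, one member for
each sign vector. Finite sums suffice, and neither boundedness nor measurability of suprema is
needed until symmetrization. -/

/-! ### Sign vectors -/

/-- The sign `±1` encoded by a Boolean. -/
def boolSign (b : Bool) : ℝ := cond b 1 (-1)

@[simp] lemma boolSign_true : boolSign true = 1 := rfl

@[simp] lemma boolSign_false : boolSign false = -1 := rfl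

lemma boolSign_not (b : Bool) : boolSign (!b) = -boolSign b := by cases b <;> simp

lemma abs_boolSign (b : Bool) : |boolSign b| = 1 := by cases b <;> simp

lemma sum_bool_fin_succ {M : Type*} [AddCommMonoid M] {n : ℕ} (f : (Fin (n + 1) → Bool) → M) :
    ∑ ε, f ε = ∑ ε : Fin n → Bool, (f (Fin.cons true ε) + f (Fin.cons false ε)) := by
  rw [← (Fin.consEquiv (fun _ : Fin (n + 1) => Bool)).sum_comp, Fintype.sum_prod_type]
  simp [Fin.consEquiv, Finset.sum_add_distrib]

lemma sum_bool_neg {n : ℕ} (f : (Fin n → Bool) → ℝ) :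
    ∑ ε : Fin n → Bool, f (fun i => !(ε i)) = ∑ ε, f ε :=
  (Equiv.piCongrRight (fun _ : Fin n => Equiv.boolNot)).sum_comp f

/-! ### Exponential moments of Rademacher sums in Hilbert space -/

/-- Convexity of the power on `[0, ∞)`: moving two points apart about a fixed midpoint increases the
sum of the values. -/
lemma add_pow_add_sub_pow_le {a s t : ℝ} (hst : |s| ≤ t) (hta : t ≤ a) (k : ℕ) :
    (a + s) ^ k + (a - s) ^ k ≤ (a + t) ^ k + (a - t) ^ k := by
  have h := abs_le.1 hst
  rcases (le_trans (abs_nonneg s) hst).eq_or_lt with h0 | h0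
  · have : s = 0 := by linarith [h.1, h.2]
    simp [this, ← h0]
  have hc := (convexOn_pow (𝕜 := ℝ) k)
  have hx : a - t ∈ Set.Ici (0 : ℝ) := by simpa using hta
  have hy : a + t ∈ Set.Ici (0 : ℝ) := by simp only [Set.mem_Ici]; linarith
  -- These are the weights that write `a + s` and `a - s` as convex combinations of `a - t` and `a +
  -- t`.
  have hp : 0 ≤ (t - s) / (2 * t) := div_nonneg (by linarith) (by linarith)
  have hq : 0 ≤ (t + s) / (2 * t) := div_nonneg (by linarith) (by linarith)
  have hpq : (t - s) / (2 * t) + (t + s) / (2 * t) = 1 := by field_simp; ring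
  have h1 := hc.2 hx hy hp hq hpq
  have h2 := hc.2 hx hy hq hp (by rw [add_comm]; exact hpq)
  simp only [smul_eq_mul] at h1 h2
  have e1 : (t - s) / (2 * t) * (a - t) + (t + s) / (2 * t) * (a + t) = a + s := by
    field_simp; ring
  have e2 : (t + s) / (2 * t) * (a - t) + (t - s) / (2 * t) * (a + t) = a - s := by
    field_simp; ring
  rw [e1] at h1
  rw [e2] at h2
  have e3 : (t - s) / (2 * t) * (a - t) ^ k + (t + s) / (2 * t) * (a + t) ^ k
      + ((t + s) / (2 * t) * (a - t) ^ k + (t - s) / (2 * t) * (a + t) ^ k)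
      = ((t - s) / (2 * t) + (t + s) / (2 * t)) * ((a + t) ^ k + (a - t) ^ k) := by ring
  rw [hpq, one_mul] at e3
  linarith

/-- The power series of `cosh` involves only the squares `‖u ± x‖² = ‖u‖² + ‖x‖² ± 2⟪u, x⟫`. By
Cauchy–Schwarz and convexity of powers, each term is largest when `u` and `x` are parallel, and then
the addition formula gives equality. -/
lemma cosh_norm_add_add_cosh_norm_sub_le {E : Type*} [NormedAddCommGroup E]
    [InnerProductSpace ℝ E] (u x : E) :
    Real.cosh ‖u + x‖ + Real.cosh ‖u - x‖ ≤ 2 * (Real.cosh ‖u‖ * Real.cosh ‖x‖) := by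
  have e : 2 * (Real.cosh ‖u‖ * Real.cosh ‖x‖)
      = Real.cosh (‖u‖ + ‖x‖) + Real.cosh (‖u‖ - ‖x‖) := by
    rw [Real.cosh_add, Real.cosh_sub]; ring
  rw [e]
  refine hasSum_le (fun k => ?_) ((Real.hasSum_cosh _).add (Real.hasSum_cosh _))
    ((Real.hasSum_cosh _).add (Real.hasSum_cosh _))
  rw [← add_div, ← add_div]
  gcongr ?_ / _
  simp only [pow_mul]
  rw [norm_add_sq_real, norm_sub_sq_real]
  have := add_pow_add_sub_pow_le (a := ‖u‖ ^ 2 + ‖x‖ ^ 2) (s := 2 * inner ℝ u x)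
    (t := 2 * (‖u‖ * ‖x‖)) (by rw [abs_mul]; simpa using abs_real_inner_le_norm u x)
    (by nlinarith [sq_nonneg (‖u‖ - ‖x‖)]) k
  rw [show ‖u‖ ^ 2 + 2 * inner ℝ u x + ‖x‖ ^ 2 = ‖u‖ ^ 2 + ‖x‖ ^ 2 + 2 * inner ℝ u x by ring,
    show ‖u‖ ^ 2 - 2 * inner ℝ u x + ‖x‖ ^ 2 = ‖u‖ ^ 2 + ‖x‖ ^ 2 - 2 * inner ℝ u x by ring]
  refine this.trans_eq ?_
  congr 2 <;> ring

lemma sum_cosh_norm_add_sum_sign_le {E : Type*} [NormedAddCommGroup E] [InnerProductSpace ℝ E]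
    {n : ℕ} (x : Fin n → E) (u : E) :
    ∑ ε : Fin n → Bool, Real.cosh ‖u + ∑ i, boolSign (ε i) • x i‖
      ≤ 2 ^ n * (Real.cosh ‖u‖ * ∏ i, Real.cosh ‖x i‖) := by
  induction n generalizing u with
  | zero => simp
  | succ n ih =>
    rw [sum_bool_fin_succ, Finset.sum_add_distrib]
    simp only [Fin.sum_univ_succ, Fin.cons_zero, Fin.cons_succ, boolSign_true, boolSign_false,
      one_smul, neg_smul, ← add_assoc]
    have h1 := ih (fun i => x i.succ) (u + x 0)
    have h2 := ih (fun i => x i.succ) (u + -x 0)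
    have h3 := cosh_norm_add_add_cosh_norm_sub_le u (x 0)
    rw [sub_eq_add_neg] at h3
    have hP : 0 ≤ (2 : ℝ) ^ n * ∏ i : Fin n, Real.cosh ‖x i.succ‖ := by
      have : ∀ i : Fin n, 0 ≤ Real.cosh ‖x i.succ‖ := fun i => (Real.cosh_pos _).le
      have := Finset.prod_nonneg (s := Finset.univ) fun i _ => this i
      positivity
    rw [Fin.prod_univ_succ]
    calc _ ≤ _ := add_le_add h1 h2
      _ = (2 ^ n * ∏ i : Fin n, Real.cosh ‖x i.succ‖)
          * (Real.cosh ‖u + x 0‖ + Real.cosh ‖u + -x 0‖) := by ring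
      _ ≤ (2 ^ n * ∏ i : Fin n, Real.cosh ‖x i.succ‖)
          * (2 * (Real.cosh ‖u‖ * Real.cosh ‖x 0‖)) := by gcongr
      _ = _ := by ring

/-- The factor `2` comes from `exp s ≤ 2 * cosh s`; the Gaussian factor comes from `cosh s ≤ exp (s²
/ 2)`, applied to each vector. -/
lemma sum_exp_norm_sum_sign_le {E : Type*} [NormedAddCommGroup E] [InnerProductSpace ℝ E]
    {n : ℕ} {x : Fin n → E} {B : ℝ} (hx : ∀ i, ‖x i‖ ≤ B) {c : ℝ} (hc : 0 ≤ c) :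
    ∑ ε : Fin n → Bool, Real.exp (c * ‖∑ i, boolSign (ε i) • x i‖)
      ≤ 2 ^ n * (2 * Real.exp (c ^ 2 * B ^ 2 * n / 2)) := by
  have h := sum_cosh_norm_add_sum_sign_le (fun i => c • x i) 0
  have hle : ∀ ε : Fin n → Bool, Real.exp (c * ‖∑ i, boolSign (ε i) • x i‖)
      ≤ 2 * Real.cosh ‖(0 : E) + ∑ i, boolSign (ε i) • c • x i‖ := by
    intro ε
    have : ‖(0 : E) + ∑ i, boolSign (ε i) • c • x i‖ = c * ‖∑ i, boolSign (ε i) • x i‖ := by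
      rw [zero_add, ← abs_of_nonneg hc, ← Real.norm_eq_abs, ← norm_smul, Finset.smul_sum]
      simp only [Real.norm_eq_abs, abs_of_nonneg hc]
      congr 1
      exact Finset.sum_congr rfl fun i _ => smul_comm _ _ _
    rw [this, Real.cosh_eq]
    have := Real.exp_pos (-(c * ‖∑ i, boolSign (ε i) • x i‖))
    linarith
  have hprod : ∏ i, Real.cosh ‖c • x i‖ ≤ Real.exp (c ^ 2 * B ^ 2 * n / 2) := by
    calc ∏ i, Real.cosh ‖c • x i‖ ≤ ∏ i : Fin n, Real.exp (c ^ 2 * B ^ 2 / 2) := by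
          refine Finset.prod_le_prod (fun i _ => (Real.cosh_pos _).le) fun i _ => ?_
          refine (Real.cosh_le_exp_half_sq _).trans (Real.exp_le_exp.2 ?_)
          rw [norm_smul, mul_pow, Real.norm_eq_abs, sq_abs]
          have := pow_le_pow_left₀ (norm_nonneg _) (hx i) 2
          gcongr
      _ = _ := by
          rw [Finset.prod_const, ← Real.exp_nat_mul]
          simp; ring
  calc _ ≤ ∑ ε : Fin n → Bool, 2 * Real.cosh ‖(0 : E) + ∑ i, boolSign (ε i) • c • x i‖ :=
        Finset.sum_le_sum fun ε _ => hle ε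
    _ ≤ 2 * (2 ^ n * (Real.cosh ‖(0 : E)‖ * ∏ i, Real.cosh ‖c • x i‖)) := by
        rw [← Finset.mul_sum]; gcongr
    _ ≤ 2 * (2 ^ n * (1 * Real.exp (c ^ 2 * B ^ 2 * n / 2))) := by
        rw [norm_zero, Real.cosh_zero]; gcongr
    _ = _ := by ring

/-! ### The contraction principle for exponential moments -/

lemma exp_add_exp_le_of_max_le {a b A B : ℝ} (hsum : a + b ≤ A + B) (hmax : max a b ≤ max A B) :
    Real.exp a + Real.exp b ≤ Real.exp A + Real.exp B := by
  wlog hab : b ≤ a generalizing a b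
  · rw [add_comm (Real.exp a)]
    exact this (by linarith) (by rwa [max_comm]) (le_of_not_ge hab)
  wlog hAB : B ≤ A generalizing A B
  · rw [add_comm (Real.exp A)]
    exact this (by linarith) (by rwa [max_comm B A]) (le_of_not_ge hAB)
  rw [max_eq_left hab, max_eq_left hAB] at hmax
  rcases le_total a B with h | h
  · exact add_le_add (Real.exp_le_exp.2 hmax) (Real.exp_le_exp.2 (hab.trans h))
  -- The remaining inequality is `(exp A - exp a) * (1 - exp (B - a)) ≥ 0`, after `b` is replaced by
  -- its upper bound `A + B - a`.
  · have h1 : Real.exp b ≤ Real.exp (A + B - a) := Real.exp_le_exp.2 (by linarith)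
    have h2 : Real.exp A * Real.exp (B - a) = Real.exp (A + B - a) := by
      rw [← Real.exp_add]; ring_nf
    have h3 : Real.exp a * Real.exp (B - a) = Real.exp B := by
      rw [← Real.exp_add]; ring_nf
    have h4 : Real.exp a ≤ Real.exp A := Real.exp_le_exp.2 hmax
    have h5 : Real.exp (B - a) ≤ 1 := Real.exp_le_one_iff.2 (by linarith)
    nlinarith

/-- One-sign contraction. Take `s₁` and `s₂` in `{t₁, t₂}` to be maximizers of `u + q` and `u - q`:
the bound on differences controls the sum of the exponents, the bound on values controls their
maximum, and this suffices for a sum of exponentials. -/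
lemma exists_exp_add_exp_le {T : Type*} (u p q : T → ℝ) (hpq : ∀ t, |p t| ≤ |q t|)
    (hpq' : ∀ t t', |p t - p t'| ≤ |q t - q t'|) (t₁ t₂ : T) :
    ∃ s₁ s₂, Real.exp (u t₁ + p t₁) + Real.exp (u t₂ - p t₂)
      ≤ Real.exp (u s₁ + q s₁) + Real.exp (u s₂ - q s₂) := by
  have h1 := hpq t₁
  have h2 := hpq t₂
  have h3 := hpq' t₁ t₂
  obtain ⟨s₁, hs₁, hs₁'⟩ : ∃ s, u t₁ + q t₁ ≤ u s + q s ∧ u t₂ + q t₂ ≤ u s + q s := by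
    rcases le_total (u t₁ + q t₁) (u t₂ + q t₂) with h | h
    exacts [⟨t₂, h, le_rfl⟩, ⟨t₁, le_rfl, h⟩]
  obtain ⟨s₂, hs₂, hs₂'⟩ : ∃ s, u t₁ - q t₁ ≤ u s - q s ∧ u t₂ - q t₂ ≤ u s - q s := by
    rcases le_total (u t₁ - q t₁) (u t₂ - q t₂) with h | h
    exacts [⟨t₂, h, le_rfl⟩, ⟨t₁, le_rfl, h⟩]
  refine ⟨s₁, s₂, exp_add_exp_le_of_max_le ?_ (max_le ?_ ?_)⟩
  · rcases abs_cases (q t₁ - q t₂) with h | h <;>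
      linarith [le_abs_self (p t₁ - p t₂)]
  · rcases abs_cases (q t₁) with h | h
    · exact le_max_of_le_left (by linarith [le_abs_self (p t₁)])
    · exact le_max_of_le_right (by linarith [le_abs_self (p t₁)])
  · rcases abs_cases (q t₂) with h | h
    · exact le_max_of_le_left (by linarith [neg_abs_le (p t₂)])
    · exact le_max_of_le_right (by linarith [neg_abs_le (p t₂)])

/-- **Contraction principle**, for a choice `τ` of an element of the class for each sign vector. -/
lemma exists_sum_exp_sign_le {T : Type*} {n : ℕ} (c : T → ℝ) (a b : T → Fin n → ℝ)
    (hab : ∀ t i, |a t i| ≤ |b t i|) (hab' : ∀ t t' i, |a t i - a t' i| ≤ |b t i - b t' i|)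
    (τ : (Fin n → Bool) → T) :
    ∃ τ' : (Fin n → Bool) → T,
      ∑ ε, Real.exp (c (τ ε) + ∑ i, boolSign (ε i) * a (τ ε) i)
        ≤ ∑ ε, Real.exp (c (τ' ε) + ∑ i, boolSign (ε i) * b (τ' ε) i) := by
  induction n generalizing c with
  | zero => exact ⟨τ, by simp⟩
  | succ n ih =>
    -- Once the first sign is fixed, its term belongs to the offset `c`, and induction replaces `a`
    -- by `b` in the other coordinates.
    have key : ∀ β : Bool, ∃ τ' : (Fin n → Bool) → T,
        ∑ ε, Real.exp (c (τ (Fin.cons β ε))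
            + ∑ i, boolSign ((Fin.cons β ε : Fin (n + 1) → Bool) i) * a (τ (Fin.cons β ε)) i)
          ≤ ∑ ε, Real.exp (c (τ' ε) + boolSign β * a (τ' ε) 0
            + ∑ i : Fin n, boolSign (ε i) * b (τ' ε) i.succ) := by
      intro β
      obtain ⟨τ', h⟩ := ih (fun t => c t + boolSign β * a t 0) (fun t i => a t i.succ)
        (fun t i => b t i.succ) (fun t i => hab _ _) (fun t t' i => hab' _ _ _)
        (fun ε => τ (Fin.cons β ε))
      refine ⟨τ', le_trans (le_of_eq ?_) h⟩
      simp only [Fin.sum_univ_succ, Fin.cons_zero, Fin.cons_succ, ← add_assoc]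
    obtain ⟨τ₁, h₁⟩ := key true
    obtain ⟨τ₂, h₂⟩ := key false
    have two : ∀ ε : Fin n → Bool, ∃ s₁ s₂, _ := fun ε =>
      exists_exp_add_exp_le (fun t => c t + ∑ i : Fin n, boolSign (ε i) * b t i.succ)
        (fun t => a t 0) (fun t => b t 0) (fun t => hab t 0) (fun t t' => hab' t t' 0)
        (τ₁ ε) (τ₂ ε)
    choose s₁ s₂ hs using two
    -- The one-sign lemma pairs the two values of the first sign; the new selection uses `s₁` on one
    -- half of the cube and `s₂` on the other.
    refine ⟨fun ε => if ε 0 then s₁ (Fin.tail ε) else s₂ (Fin.tail ε), ?_⟩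
    rw [sum_bool_fin_succ, sum_bool_fin_succ, Finset.sum_add_distrib]
    refine (add_le_add h₁ h₂).trans ?_
    rw [← Finset.sum_add_distrib]
    refine Finset.sum_le_sum fun ε _ => ?_
    refine le_trans (le_of_eq ?_) ((hs ε).trans (le_of_eq ?_))
    · simp only [boolSign_true, boolSign_false]
      congr 2 <;> ring
    · simp only [Fin.sum_univ_succ, Fin.cons_zero, Fin.cons_succ, Fin.tail_cons,
        boolSign_true, boolSign_false]
      simp only [if_true, Bool.false_eq_true, if_false]
      congr 2 <;> ring

/-- Jensen's inequality and a choice of `c` turn a family of exponential bounds into a bound on the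
mean. The prefactor `2 ^ k` enters only through its logarithm, so depth costs `√k`. -/
lemma sum_le_of_forall_sum_exp_le {n k : ℕ} (hn : 1 ≤ n) (hk : 1 ≤ k) {V : ℝ} (hV : 0 ≤ V)
    {Y : (Fin n → Bool) → ℝ}
    (hY : ∀ c : ℝ, 0 < c →
      ∑ ε, Real.exp (c * Y ε) ≤ 2 ^ n * (2 ^ k * Real.exp (c ^ 2 * V ^ 2 * n / 2))) :
    ∑ ε, Y ε ≤ 2 ^ n * (V * √(3 * k) * √n) := by
  have hn' : (0 : ℝ) < n := by exact_mod_cast hn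
  have hk' : (0 : ℝ) < k := by exact_mod_cast hk
  have key : ∀ c : ℝ, 0 < c → c * ∑ ε, Y ε ≤ 2 ^ n * (k * Real.log 2 + c ^ 2 * V ^ 2 * n / 2) := by
    intro c hc
    set A := k * Real.log 2 + c ^ 2 * V ^ 2 * n / 2 with hA
    have h1 : (2 : ℝ) ^ k * Real.exp (c ^ 2 * V ^ 2 * n / 2) = Real.exp A := by
      rw [hA, Real.exp_add, Real.exp_nat_mul, Real.exp_log (by norm_num)]
    -- The tangent of `exp` at `A` lies below its graph; summation over `ε` gives Jensen's
    -- inequality.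
    have h2 : ∀ ε, Real.exp A * (c * Y ε - A + 1) ≤ Real.exp (c * Y ε) := by
      intro ε
      have := Real.add_one_le_exp (c * Y ε - A)
      calc _ ≤ Real.exp A * Real.exp (c * Y ε - A) := by gcongr
        _ = _ := by rw [← Real.exp_add]; ring_nf
    have h3 := (Finset.sum_le_sum fun ε (_ : ε ∈ Finset.univ) => h2 ε).trans (hY c hc)
    rw [h1, ← Finset.mul_sum, mul_comm _ (Real.exp A), Finset.sum_add_distrib,
      Finset.sum_sub_distrib, ← Finset.mul_sum] at h3
    have h4 := le_of_mul_le_mul_left h3 (Real.exp_pos A)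
    simp at h4
    linarith
  -- For `V = 0` the chosen `c` below would divide by zero; instead, arbitrarily large `c` exclude a
  -- positive sum.
  rcases hV.eq_or_lt with rfl | hV
  · have hz : ∑ ε, Y ε ≤ 0 := by
      by_contra! hpos
      have := key ((2 ^ n * (k * Real.log 2) + 1) / ∑ ε, Y ε) (by
        have := Real.log_pos one_lt_two
        positivity)
      rw [div_mul_cancel₀ _ hpos.ne'] at this
      norm_num at this
    simpa using hz
  -- With this `c` the variance term is `k / 2`, of the order of the term `k * log 2`. The constant
  -- is `log 2 + 1/2`, which is below `√3`.
  · have h := key (√k / (V * √n)) (by positivity)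
    have e : (√k / (V * √n)) ^ 2 * V ^ 2 * n / 2 = k / 2 := by
      rw [div_pow, mul_pow, Real.sq_sqrt hk'.le, Real.sq_sqrt hn'.le]
      field_simp
    rw [e] at h
    have h' : ∑ ε, Y ε ≤ 2 ^ n * (k * (Real.log 2 + 1 / 2)) * (V * √n) / √k := by
      rw [le_div_iff₀ (by positivity)]
      rw [div_mul_eq_mul_div, div_le_iff₀ (by positivity)] at h
      linarith
    refine h'.trans ?_
    rw [div_le_iff₀ (by positivity), Real.sqrt_mul (by norm_num)]
    have e2 : 2 ^ n * (V * (√3 * √k) * √n) * √k = 2 ^ n * (k * √3) * (V * √n) := by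
      have := Real.mul_self_sqrt hk'.le
      calc _ = 2 ^ n * ((√k * √k) * √3) * (V * √n) := by ring
        _ = _ := by rw [this]
    rw [e2]
    have h3 : Real.log 2 + 1 / 2 ≤ √3 := by
      refine Real.le_sqrt_of_sq_le ?_
      nlinarith [Real.log_two_lt_d9, Real.log_two_gt_d9]
    gcongr

/-! ### Norm bounds and peeling for homogeneous networks -/

open scoped Matrix.Norms.Frobenius in
lemma frobenius_norm_sq {p q : ℕ} (W : Matrix (Fin p) (Fin q) ℝ) :
    ‖W‖ ^ 2 = ∑ t, ‖WithLp.toLp 2 (W t)‖ ^ 2 := by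
  rw [Matrix.frobenius_norm_def, ← Real.sqrt_eq_rpow, Real.sq_sqrt (by positivity)]
  simp [EuclideanSpace.norm_sq_eq]

lemma mulVec_apply_eq_inner {p q : ℕ} (W : Matrix (Fin p) (Fin q) ℝ) (v : Fin q → ℝ) (t : Fin p) :
    (W *ᵥ v) t = inner ℝ (WithLp.toLp 2 v) (WithLp.toLp 2 (W t)) := by
  simp [Matrix.mulVec, dotProduct, PiLp.inner_apply]

open scoped Matrix.Norms.Frobenius in
lemma norm_toLp_le_of_abs_le {p q : ℕ} (W : Matrix (Fin p) (Fin q) ℝ) {y : Fin p → ℝ} {c : ℝ}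
    (hc : 0 ≤ c) (h : ∀ t, |y t| ≤ ‖WithLp.toLp 2 (W t)‖ * c) :
    ‖WithLp.toLp 2 y‖ ≤ ‖W‖ * c := by
  refine le_of_sq_le_sq ?_ (by positivity)
  rw [mul_pow, frobenius_norm_sq, EuclideanSpace.norm_sq_eq, Finset.sum_mul]
  refine Finset.sum_le_sum fun t _ => ?_
  rw [← mul_pow]
  exact pow_le_pow_left₀ (norm_nonneg _) (h t) 2

open scoped Matrix.Norms.Frobenius in
lemma norm_toLp_mulVec_le {p q : ℕ} (W : Matrix (Fin p) (Fin q) ℝ) (v : Fin q → ℝ) :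
    ‖WithLp.toLp 2 (W *ᵥ v)‖ ≤ ‖W‖ * ‖WithLp.toLp 2 v‖ := by
  refine norm_toLp_le_of_abs_le W (norm_nonneg _) fun t => ?_
  rw [mulVec_apply_eq_inner, mul_comm]
  exact abs_real_inner_le_norm _ _

open scoped Matrix.Norms.Frobenius in
/-- The norm of a signed sum of outputs of a homogeneous layer is controlled by a single unit. -/
lemma exists_norm_sum_layer_le {n p q : ℕ} (W : Matrix (Fin p) (Fin q) ℝ) {f : ℝ → ℝ}
    (hf : ∀ c : ℝ, 0 ≤ c → ∀ u : ℝ, f (c * u) = c * f u) (s : Fin n → ℝ) (h : Fin n → Fin q → ℝ) :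
    ∃ w : EuclideanSpace ℝ (Fin q), ‖w‖ ≤ 1 ∧
      ‖∑ i, s i • WithLp.toLp 2 (fun t => f ((W *ᵥ h i) t))‖
        ≤ ‖W‖ * |∑ i, s i * f (inner ℝ (WithLp.toLp 2 (h i)) w)| := by
  -- The normalized rows of `W`. Homogeneity pulls the row norms out of `f`, and their squares sum
  -- to the squared Frobenius norm. A zero row gives `w t = 0` because `0⁻¹ = 0`.
  let w : Fin p → EuclideanSpace ℝ (Fin q) := fun t =>
    ‖WithLp.toLp 2 (W t)‖⁻¹ • WithLp.toLp 2 (W t)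
  have hw : ∀ t, ‖w t‖ ≤ 1 := fun t => by
    simp only [w, norm_smul, norm_inv, norm_norm]
    exact inv_mul_le_one
  let y : Fin p → ℝ := fun t => ∑ i, s i * f (inner ℝ (WithLp.toLp 2 (h i)) (w t))
  have hy : ∀ t, ∑ i, s i * f ((W *ᵥ h i) t) = ‖WithLp.toLp 2 (W t)‖ * y t := by
    intro t
    rw [Finset.mul_sum]
    refine Finset.sum_congr rfl fun i _ => ?_
    rw [mul_left_comm, ← hf _ (norm_nonneg _), ← inner_smul_right, mulVec_apply_eq_inner]
    congr 3
    rcases eq_or_ne ‖WithLp.toLp 2 (W t)‖ 0 with h0 | h0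
    · simp only [h0, zero_smul]; exact norm_eq_zero.1 h0
    · simp only [w, smul_smul, mul_inv_cancel₀ h0, one_smul]
  have hsum : ∑ i, s i • WithLp.toLp 2 (fun t => f ((W *ᵥ h i) t))
      = WithLp.toLp 2 (fun t => ‖WithLp.toLp 2 (W t)‖ * y t) := by
    ext t
    simp [← hy t]
  rw [hsum]
  rcases isEmpty_or_nonempty (Fin p) with hp | hp
  · refine ⟨0, by simp, ?_⟩
    exact norm_toLp_le_of_abs_le W (abs_nonneg _) fun t => hp.elim t
  · obtain ⟨t₀, ht₀⟩ := Finite.exists_max fun t => |y t|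
    refine ⟨w t₀, hw t₀, norm_toLp_le_of_abs_le W (abs_nonneg _) fun t => ?_⟩
    rw [abs_mul, abs_norm]
    exact mul_le_mul_of_nonneg_left (ht₀ t) (norm_nonneg _)

lemma eq_zero_of_homogeneous {f : ℝ → ℝ}
    (hf : ∀ c : ℝ, 0 ≤ c → ∀ u : ℝ, f (c * u) = c * f u) : f 0 = 0 := by
  simpa using hf 0 le_rfl 0

lemma abs_sub_le_of_lipschitzWith {f : ℝ → ℝ} {K : ℝ≥0} (hf : LipschitzWith K f) (u v : ℝ) :
    |f u - f v| ≤ K * |u - v| := by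
  simpa [Real.dist_eq] using hf.dist_le_mul u v

lemma abs_mul_sub_mul_le {f : ℝ → ℝ} {K : ℝ≥0} (hf : LipschitzWith K f) {c : ℝ} (hc : 0 ≤ c)
    (u v : ℝ) : |c * f u - c * f v| ≤ |c * K * u - c * K * v| := by
  have hcK : 0 ≤ c * K := by positivity
  rw [← mul_sub, ← mul_sub, abs_mul, abs_of_nonneg hc, abs_mul, abs_of_nonneg hcK, mul_assoc]
  exact mul_le_mul_of_nonneg_left (abs_sub_le_of_lipschitzWith hf u v) hc

open scoped Matrix.Norms.Frobenius in
lemma norm_hiddenLayers_le (e : ℕ → ℕ) (a : ℕ → ℝ → ℝ) (A K : ℕ → ℝ≥0) (j : ℕ)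
    (hLip : ∀ i ∈ Finset.Icc 1 j, LipschitzWith (K i) (a i))
    (hHom : ∀ i ∈ Finset.Icc 1 j, ∀ c : ℝ, 0 ≤ c → ∀ u : ℝ, a i (c * u) = c * a i u)
    (W : (i : Fin j) → Matrix (Fin (e (i + 1))) (Fin (e i)) ℝ)
    (hW : ∀ i : Fin j, ‖W i‖ ≤ A (i + 1)) (x : Fin (e 0) → ℝ) :
    ‖WithLp.toLp 2 (hiddenLayers e a j W x)‖
      ≤ (∏ i ∈ Finset.Icc 1 j, ((A i : ℝ) * K i)) * ‖WithLp.toLp 2 x‖ := by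
  induction j with
  | zero => simp [hiddenLayers]
  | succ j ih =>
    have hmem : j + 1 ∈ Finset.Icc 1 (j + 1) := by simp
    have hsub : Finset.Icc 1 j ⊆ Finset.Icc 1 (j + 1) := Finset.Icc_subset_Icc_right (by omega)
    have ih' := ih (fun i hi => hLip i (hsub hi)) (fun i hi => hHom i (hsub hi))
      (fun i => W i.castSucc) (fun i => hW i.castSucc)
    rw [Finset.prod_Icc_succ_top (by omega)]
    have h1 : ‖WithLp.toLp 2 (hiddenLayers e a (j + 1) W x)‖
        ≤ K (j + 1) * ‖WithLp.toLp 2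
            (W (Fin.last j) *ᵥ hiddenLayers e a j (fun i => W i.castSucc) x)‖ := by
      refine le_of_sq_le_sq ?_ (by positivity)
      rw [mul_pow, EuclideanSpace.norm_sq_eq, EuclideanSpace.norm_sq_eq, Finset.mul_sum]
      refine Finset.sum_le_sum fun t _ => ?_
      rw [← mul_pow]
      refine pow_le_pow_left₀ (norm_nonneg _) ?_ 2
      have := abs_sub_le_of_lipschitzWith (hLip _ hmem)
        ((W (Fin.last j) *ᵥ hiddenLayers e a j (fun i => W i.castSucc) x) t) 0
      rw [eq_zero_of_homogeneous (hHom _ hmem), sub_zero, sub_zero] at this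
      exact this
    have h2 := norm_toLp_mulVec_le (W (Fin.last j))
      (hiddenLayers e a j (fun i => W i.castSucc) x)
    have h3 : ‖W (Fin.last j)‖ ≤ A (j + 1) := hW (Fin.last j)
    calc _ ≤ _ := h1
      _ ≤ K (j + 1) * (A (j + 1) * ((∏ i ∈ Finset.Icc 1 j, ((A i : ℝ) * K i))
            * ‖WithLp.toLp 2 x‖)) := by
          gcongr
          exact h2.trans (mul_le_mul h3 ih' (norm_nonneg _) (NNReal.coe_nonneg _))
      _ = _ := by ring

lemma sum_exp_abs_le {n : ℕ} (Y : (Fin n → Bool) → ℝ) :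
    ∑ ε, Real.exp |Y ε| ≤ ∑ ε, Real.exp (Y ε) + ∑ ε, Real.exp (-Y ε) := by
  rw [← Finset.sum_add_distrib]
  refine Finset.sum_le_sum fun ε _ => ?_
  rcases abs_choice (Y ε) with h | h <;> rw [h] <;>
    linarith [Real.exp_pos (Y ε), Real.exp_pos (-Y ε)]

open scoped Matrix.Norms.Frobenius in
/-- Peeling off the hidden layers of a homogeneous network costs a factor `2` per layer. -/
lemma exists_sum_exp_norm_hiddenLayers_le {T : Type*} {n : ℕ} (e : ℕ → ℕ) (a : ℕ → ℝ → ℝ)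
    (A K : ℕ → ℝ≥0) (j : ℕ)
    (hLip : ∀ i ∈ Finset.Icc 1 j, LipschitzWith (K i) (a i))
    (hHom : ∀ i ∈ Finset.Icc 1 j, ∀ c : ℝ, 0 ≤ c → ∀ u : ℝ, a i (c * u) = c * a i u)
    (x : T → Fin n → EuclideanSpace ℝ (Fin (e 0))) (τ : (Fin n → Bool) → T)
    (W : (Fin n → Bool) → (i : Fin j) → Matrix (Fin (e (i + 1))) (Fin (e i)) ℝ)
    (hW : ∀ ε (i : Fin j), ‖W ε i‖ ≤ A (i + 1)) {c : ℝ} (hc : 0 ≤ c) :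
    ∃ τ' : (Fin n → Bool) → T,
      ∑ ε, Real.exp (c * ‖∑ i, boolSign (ε i) •
          WithLp.toLp 2 (hiddenLayers e a j (W ε) (x (τ ε) i).ofLp)‖)
        ≤ 2 ^ j * ∑ ε, Real.exp (c * (∏ i ∈ Finset.Icc 1 j, ((A i : ℝ) * K i))
          * ‖∑ i, boolSign (ε i) • x (τ' ε) i‖) := by
  induction j generalizing c τ with
  | zero => exact ⟨τ, by simp [hiddenLayers]⟩
  | succ j ih =>
    have hmem : j + 1 ∈ Finset.Icc 1 (j + 1) := by simp
    have hsub : Finset.Icc 1 j ⊆ Finset.Icc 1 (j + 1) := Finset.Icc_subset_Icc_right (by omega)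
    set f := a (j + 1) with hf
    have hf0 : f 0 = 0 := eq_zero_of_homogeneous (hHom _ hmem)
    let B := {V : (i : Fin j) → Matrix (Fin (e (i + 1))) (Fin (e i)) ℝ //
      ∀ i : Fin j, ‖V i‖ ≤ A (i + 1)}
    -- The index set of the contraction contains the lower layers and a unit-ball vector, so the
    -- selected function may change all of these with the signs.
    let T' := T × B × {w : EuclideanSpace ℝ (Fin (e j)) // ‖w‖ ≤ 1}
    let u : T' → Fin n → ℝ := fun p i => inner ℝ
      (WithLp.toLp 2 (hiddenLayers e a j p.2.1.1 (x p.1 i).ofLp)) p.2.2.1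
    choose w hw hws using fun ε => exists_norm_sum_layer_le (W ε (Fin.last j)) (hHom _ hmem)
      (fun i => boolSign (ε i))
      (fun i => hiddenLayers e a j (fun i => W ε i.castSucc) (x (τ ε) i).ofLp)
    let σ : (Fin n → Bool) → T' := fun ε =>
      (τ ε, ⟨fun i => W ε i.castSucc, fun i => hW ε i.castSucc⟩, ⟨w ε, hw ε⟩)
    have hA : ∀ ε, ‖W ε (Fin.last j)‖ ≤ A (j + 1) := fun ε => hW ε (Fin.last j)
    set c' := c * A (j + 1) with hc'
    have hc'0 : 0 ≤ c' := by positivity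
    have h1 : ∑ ε, Real.exp (c * ‖∑ i, boolSign (ε i) •
          WithLp.toLp 2 (hiddenLayers e a (j + 1) (W ε) (x (τ ε) i).ofLp)‖)
        ≤ ∑ ε, Real.exp |c' * ∑ i, boolSign (ε i) * f (u (σ ε) i)| := by
      refine Finset.sum_le_sum fun ε _ => Real.exp_le_exp.2 ?_
      rw [abs_mul, abs_of_nonneg hc'0, hc', mul_assoc]
      refine mul_le_mul_of_nonneg_left ((hws ε).trans ?_) hc
      exact mul_le_mul_of_nonneg_right (hA ε) (abs_nonneg _)
    have contr : ∀ ρ : (Fin n → Bool) → T', ∃ τ' : (Fin n → Bool) → T,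
        ∑ ε, Real.exp (c' * ∑ i, boolSign (ε i) * f (u (ρ ε) i))
          ≤ 2 ^ j * ∑ ε, Real.exp (c * (∏ i ∈ Finset.Icc 1 (j + 1), ((A i : ℝ) * K i))
            * ‖∑ i, boolSign (ε i) • x (τ' ε) i‖) := by
      intro ρ
      have hb := abs_mul_sub_mul_le (f := f) (hLip _ hmem) hc'0
      obtain ⟨ρ', hρ'⟩ := exists_sum_exp_sign_le (fun _ : T' => 0) (fun t i => c' * f (u t i))
        (fun t i => c' * K (j + 1) * u t i)
        (fun t i => by simpa [hf0] using hb (u t i) 0) (fun t t' i => hb _ _) ρ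
      obtain ⟨τ', hτ'⟩ := ih (fun i hi => hLip i (hsub hi)) (fun i hi => hHom i (hsub hi))
        (fun ε => (ρ' ε).1) (fun ε => (ρ' ε).2.1.1) (fun ε => (ρ' ε).2.1.2)
        (c := c' * K (j + 1)) (by positivity)
      refine ⟨τ', ?_⟩
      calc _ ≤ ∑ ε, Real.exp (0 + ∑ i, boolSign (ε i) * (c' * K (j + 1) * u (ρ' ε) i)) := by
            refine le_trans (le_of_eq (Finset.sum_congr rfl fun ε _ => ?_)) hρ'
            rw [zero_add, Finset.mul_sum]
            congr 1
            exact Finset.sum_congr rfl fun i _ => by ring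
        _ ≤ ∑ ε, Real.exp (c' * K (j + 1) * ‖∑ i, boolSign (ε i) •
              WithLp.toLp 2 (hiddenLayers e a j (ρ' ε).2.1.1 (x (ρ' ε).1 i).ofLp)‖) := by
            refine Finset.sum_le_sum fun ε _ => Real.exp_le_exp.2 ?_
            have e1 : 0 + ∑ i, boolSign (ε i) * (c' * K (j + 1) * u (ρ' ε) i)
                = c' * K (j + 1) * inner ℝ (∑ i, boolSign (ε i) •
                  WithLp.toLp 2 (hiddenLayers e a j (ρ' ε).2.1.1 (x (ρ' ε).1 i).ofLp))
                  (ρ' ε).2.2.1 := by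
              rw [sum_inner, zero_add, Finset.mul_sum]
              refine Finset.sum_congr rfl fun i _ => ?_
              rw [real_inner_smul_left]
              simp only [u]
              ring
            rw [e1]
            -- The linear unit left by contraction is at most the norm of the signed sum, which is
            -- the quantity of the induction hypothesis for one layer fewer.
            refine mul_le_mul_of_nonneg_left ((real_inner_le_norm _ _).trans ?_) (by positivity)
            exact mul_le_of_le_one_right (norm_nonneg _) (ρ' ε).2.2.2
        _ ≤ _ := hτ'
        _ = _ := by
            rw [Finset.prod_Icc_succ_top (by omega), hc']
            congr 2
            funext ε
            ring_nf
    obtain ⟨τ₁, hτ₁⟩ := contr σ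
    -- The exponential with the minus sign has the same form after all signs are flipped, with a
    -- different selection. The larger of the two resulting sums is kept, whence the factor `2`.
    obtain ⟨τ₂, hτ₂⟩ := contr fun ε => σ fun i => !(ε i)
    have hneg : ∑ ε, Real.exp (-(c' * ∑ i, boolSign (ε i) * f (u (σ ε) i)))
        = ∑ ε : Fin n → Bool, Real.exp (c' * ∑ i, boolSign (ε i) *
            f (u (σ fun i => !(ε i)) i)) := by
      rw [← sum_bool_neg]
      refine Finset.sum_congr rfl fun ε _ => ?_
      simp only [boolSign_not, neg_mul, Finset.sum_neg_distrib, mul_neg, neg_neg]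
    have h2 := h1.trans (sum_exp_abs_le _)
    rw [hneg] at h2
    rcases le_total
      (∑ ε, Real.exp (c * (∏ i ∈ Finset.Icc 1 (j + 1), ((A i : ℝ) * K i))
            * ‖∑ i, boolSign (ε i) • x (τ₁ ε) i‖))
      (∑ ε, Real.exp (c * (∏ i ∈ Finset.Icc 1 (j + 1), ((A i : ℝ) * K i))
            * ‖∑ i, boolSign (ε i) • x (τ₂ ε) i‖)) with h | h
    · refine ⟨τ₂, (h2.trans (add_le_add (hτ₁.trans ?_) hτ₂)).trans_eq
        (by rw [pow_succ, mul_assoc, two_mul, mul_add])⟩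
      gcongr
    · refine ⟨τ₁, (h2.trans (add_le_add hτ₁ (hτ₂.trans ?_))).trans_eq
        (by rw [pow_succ, mul_assoc, two_mul, mul_add])⟩
      gcongr

/-! ### Discriminators and generators -/

/-- The pre-activation `w_kᵀ r_{k-1}(W_{k-1} … r_1(W_1 x))` of the output of the discriminator. -/
noncomputable def logit (e : ℕ → ℕ) (r : ℕ → ℝ → ℝ) (k : ℕ) (ω : DiscParam e k)
    (x : EuclideanSpace ℝ (Fin (e 0))) : ℝ :=
  ∑ t, ω.2 t * hiddenLayers e r (k - 1) ω.1 x.ofLp t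

lemma logit_eq_inner (e : ℕ → ℕ) (r : ℕ → ℝ → ℝ) (k : ℕ) (ω : DiscParam e k)
    (x : EuclideanSpace ℝ (Fin (e 0))) :
    logit e r k ω x = inner ℝ (WithLp.toLp 2 (hiddenLayers e r (k - 1) ω.1 x.ofLp)) ω.2 := by
  simp [logit, PiLp.inner_apply]

lemma capacity_nonneg (h : ℕ) (A T : ℕ → ℝ≥0) : 0 ≤ capacity h A T :=
  mul_nonneg (NNReal.coe_nonneg _) (Finset.prod_nonneg fun _ _ => by positivity)

section Bounds

variable {e : ℕ → ℕ} {r : ℕ → ℝ → ℝ} {R M : ℕ → ℝ≥0} {k : ℕ}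

lemma abs_logit_le
    (hrLip : ∀ i ∈ Finset.Icc 1 (k - 1), LipschitzWith (R i) (r i))
    (hrHom : ∀ i ∈ Finset.Icc 1 (k - 1), ∀ c : ℝ, 0 ≤ c → ∀ p : ℝ, r i (c * p) = c * r i p)
    {ω : DiscParam e k} (hω : ω ∈ boundedDisc e k M) (x : EuclideanSpace ℝ (Fin (e 0))) :
    |logit e r k ω x| ≤ capacity k M R * ‖x‖ := by
  rw [logit_eq_inner]
  refine (abs_real_inner_le_norm _ _).trans ?_
  have h := norm_hiddenLayers_le e r M R (k - 1) hrLip hrHom ω.1 hω.1 x.ofLp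
  calc _ ≤ ((∏ i ∈ Finset.Icc 1 (k - 1), ((M i : ℝ) * R i)) * ‖x‖) * M k :=
        mul_le_mul h hω.2 (norm_nonneg _) ((norm_nonneg _).trans h)
    _ = _ := by rw [capacity]; ring

lemma norm_generator_le {q : ℕ → ℕ} {s : ℕ → ℝ → ℝ} {T N : ℕ → ℝ≥0} {l d : ℕ}
    (hsLip : ∀ j ∈ Finset.Icc 1 (l - 1), LipschitzWith (T j) (s j))
    (hsHom : ∀ j ∈ Finset.Icc 1 (l - 1), ∀ c : ℝ, 0 ≤ c → ∀ p : ℝ, s j (c * p) = c * s j p)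
    {θ : GenParam q l d} (hθ : θ ∈ boundedGen q l d N) (z : EuclideanSpace ℝ (Fin (q 0))) :
    ‖generator q s l d θ z‖ ≤ capacity l N T * ‖z‖ := by
  have h := norm_hiddenLayers_le q s N T (l - 1) hsLip hsHom θ.1 hθ.1 z.ofLp
  refine (norm_toLp_mulVec_le _ _).trans ?_
  calc _ ≤ (N l : ℝ) * ((∏ i ∈ Finset.Icc 1 (l - 1), ((N i : ℝ) * T i)) * ‖z‖) :=
        mul_le_mul hθ.2 h (norm_nonneg _) (NNReal.coe_nonneg _)
    _ = _ := by rw [capacity]; ring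

/-- The inputs may depend on an index selected along with the signs; for the composed network this
index is the generator parameter, and peeling then continues into the generator. -/
lemma exists_sum_exp_logit_le {ι : Type*} {n : ℕ}
    (hrLip : ∀ i ∈ Finset.Icc 1 (k - 1), LipschitzWith (R i) (r i))
    (hrHom : ∀ i ∈ Finset.Icc 1 (k - 1), ∀ c : ℝ, 0 ≤ c → ∀ p : ℝ, r i (c * p) = c * r i p)
    (x : ι → Fin n → EuclideanSpace ℝ (Fin (e 0))) (τ : (Fin n → Bool) → ι)
    (ω : (Fin n → Bool) → DiscParam e k) (hω : ∀ ε, ω ε ∈ boundedDisc e k M)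
    {c : ℝ} (hc : 0 ≤ c) :
    ∃ τ' : (Fin n → Bool) → ι,
      ∑ ε, Real.exp (c * ∑ i, boolSign (ε i) * logit e r k (ω ε) (x (τ ε) i))
        ≤ 2 ^ (k - 1) * ∑ ε, Real.exp (c * capacity k M R
          * ‖∑ i, boolSign (ε i) • x (τ' ε) i‖) := by
  obtain ⟨τ', h⟩ := exists_sum_exp_norm_hiddenLayers_le e r M R (k - 1) hrLip hrHom x τ
    (fun ε => (ω ε).1) (fun ε => (hω ε).1) (c := c * M k) (by positivity)
  refine ⟨τ', le_trans (Finset.sum_le_sum fun ε _ => Real.exp_le_exp.2 ?_)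
    (h.trans_eq ?_)⟩
  · have e1 : ∑ i, boolSign (ε i) * logit e r k (ω ε) (x (τ ε) i)
        = inner ℝ (∑ i, boolSign (ε i) •
          WithLp.toLp 2 (hiddenLayers e r (k - 1) (ω ε).1 (x (τ ε) i).ofLp)) (ω ε).2 := by
      rw [sum_inner]
      refine Finset.sum_congr rfl fun i _ => ?_
      rw [real_inner_smul_left, logit_eq_inner]
    rw [e1, mul_assoc]
    refine mul_le_mul_of_nonneg_left ((real_inner_le_norm _ _).trans ?_) hc
    rw [mul_comm]
    exact mul_le_mul_of_nonneg_right (hω ε).2 (norm_nonneg _)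
  · rw [capacity]
    congr 2
    funext ε
    ring_nf

lemma exists_sum_exp_norm_generator_le {ι : Type*} {n : ℕ}
    {q : ℕ → ℕ} {s : ℕ → ℝ → ℝ} {T N : ℕ → ℝ≥0} {l d : ℕ}
    (hsLip : ∀ j ∈ Finset.Icc 1 (l - 1), LipschitzWith (T j) (s j))
    (hsHom : ∀ j ∈ Finset.Icc 1 (l - 1), ∀ c : ℝ, 0 ≤ c → ∀ p : ℝ, s j (c * p) = c * s j p)
    (z : ι → Fin n → EuclideanSpace ℝ (Fin (q 0))) (τ : (Fin n → Bool) → ι)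
    (θ : (Fin n → Bool) → GenParam q l d) (hθ : ∀ ε, θ ε ∈ boundedGen q l d N)
    {c : ℝ} (hc : 0 ≤ c) :
    ∃ τ' : (Fin n → Bool) → ι,
      ∑ ε, Real.exp (c * ‖∑ i, boolSign (ε i) • generator q s l d (θ ε) (z (τ ε) i)‖)
        ≤ 2 ^ (l - 1) * ∑ ε, Real.exp (c * capacity l N T
          * ‖∑ i, boolSign (ε i) • z (τ' ε) i‖) := by
  obtain ⟨τ', h⟩ := exists_sum_exp_norm_hiddenLayers_le q s N T (l - 1) hsLip hsHom z τ
    (fun ε => (θ ε).1) (fun ε => (hθ ε).1) (c := c * N l) (by positivity)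
  refine ⟨τ', le_trans (Finset.sum_le_sum fun ε _ => Real.exp_le_exp.2 ?_)
    (h.trans_eq ?_)⟩
  · have e1 : ∑ i, boolSign (ε i) • generator q s l d (θ ε) (z (τ ε) i)
        = WithLp.toLp 2 ((θ ε).2 *ᵥ (∑ i, boolSign (ε i) •
          WithLp.toLp 2 (hiddenLayers q s (l - 1) (θ ε).1 (z (τ ε) i).ofLp)).ofLp) := by
      simp [generator, Matrix.mulVec_sum, Matrix.mulVec_smul]
    rw [e1, mul_assoc]
    refine mul_le_mul_of_nonneg_left ((norm_toLp_mulVec_le _ _).trans ?_) hc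
    exact mul_le_mul_of_nonneg_right (hθ ε).2 (norm_nonneg _)
  · rw [capacity]
    congr 2
    funext ε
    ring_nf

/-- The Rademacher complexity of a Lipschitz function of the logit of a discriminator. -/
lemma sum_sign_comp_logit_le {n : ℕ} (hn : 1 ≤ n) (hk : 1 ≤ k)
    (hrLip : ∀ i ∈ Finset.Icc 1 (k - 1), LipschitzWith (R i) (r i))
    (hrHom : ∀ i ∈ Finset.Icc 1 (k - 1), ∀ c : ℝ, 0 ≤ c → ∀ p : ℝ, r i (c * p) = c * r i p)
    {g : ℝ → ℝ} {K : ℝ≥0} (hg : LipschitzWith K g) (hg0 : g 0 = 0)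
    {B : ℝ} (hB : 0 ≤ B) (x : Fin n → EuclideanSpace ℝ (Fin (e 0))) (hx : ∀ i, ‖x i‖ ≤ B)
    (ω : (Fin n → Bool) → boundedDisc e k M) :
    ∑ ε, ∑ i, boolSign (ε i) * g (logit e r k (ω ε) (x i))
      ≤ 2 ^ n * (K * (capacity k M R * B) * √(3 * k) * √n) := by
  have hU := capacity_nonneg k M R
  refine sum_le_of_forall_sum_exp_le hn hk (by positivity) fun c hc => ?_
  have hb := abs_mul_sub_mul_le hg hc.le
  obtain ⟨ω', hω'⟩ := exists_sum_exp_sign_le (fun _ : boundedDisc e k M => 0)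
    (fun t i => c * g (logit e r k t (x i))) (fun t i => c * K * logit e r k t (x i))
    (fun t i => by simpa [hg0] using hb (logit e r k t (x i)) 0) (fun t t' i => hb _ _) ω
  obtain ⟨τ', hτ'⟩ := exists_sum_exp_logit_le hrLip hrHom (fun _ : Unit => x) (fun _ => ())
    (fun ε => (ω' ε).1) (fun ε => (ω' ε).2) (c := c * K) (by positivity)
  have h3 := sum_exp_norm_sum_sign_le hx (c := c * K * capacity k M R) (by positivity)
  calc _ ≤ ∑ ε, Real.exp (c * K * ∑ i, boolSign (ε i) * logit e r k (ω' ε) (x i)) := by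
        refine le_trans (le_of_eq (Finset.sum_congr rfl fun ε _ => ?_))
          (hω'.trans_eq (Finset.sum_congr rfl fun ε _ => ?_))
        · rw [zero_add, Finset.mul_sum]
          congr 1
          exact Finset.sum_congr rfl fun i _ => by ring
        · rw [zero_add, Finset.mul_sum]
          congr 1
          exact Finset.sum_congr rfl fun i _ => by ring
    _ ≤ _ := hτ'
    _ ≤ _ := mul_le_mul_of_nonneg_left h3 (by positivity)
    _ = 2 ^ n * (2 ^ (k - 1 + 1) * Real.exp ((c * K * capacity k M R) ^ 2 * B ^ 2 * n / 2)) := by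
        ring
    _ = _ := by
        rw [Nat.sub_add_cancel hk]
        congr 3
        ring

/-- The Rademacher complexity of a Lipschitz function of the logit of a discriminator applied to
a generator. -/
lemma sum_sign_comp_logit_generator_le {n : ℕ} (hn : 1 ≤ n) (hk : 1 ≤ k)
    {q : ℕ → ℕ} {s : ℕ → ℝ → ℝ} {T N : ℕ → ℝ≥0} {l : ℕ} (hl : 1 ≤ l)
    (hrLip : ∀ i ∈ Finset.Icc 1 (k - 1), LipschitzWith (R i) (r i))
    (hrHom : ∀ i ∈ Finset.Icc 1 (k - 1), ∀ c : ℝ, 0 ≤ c → ∀ p : ℝ, r i (c * p) = c * r i p)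
    (hsLip : ∀ j ∈ Finset.Icc 1 (l - 1), LipschitzWith (T j) (s j))
    (hsHom : ∀ j ∈ Finset.Icc 1 (l - 1), ∀ c : ℝ, 0 ≤ c → ∀ p : ℝ, s j (c * p) = c * s j p)
    {g : ℝ → ℝ} {K : ℝ≥0} (hg : LipschitzWith K g) (hg0 : g 0 = 0)
    {B : ℝ} (hB : 0 ≤ B) (z : Fin n → EuclideanSpace ℝ (Fin (q 0))) (hz : ∀ i, ‖z i‖ ≤ B)
    (ρ : (Fin n → Bool) → boundedDisc e k M × boundedGen q l (e 0) N) :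
    ∑ ε, ∑ i, boolSign (ε i) *
        g (logit e r k (ρ ε).1 (generator q s l (e 0) (ρ ε).2 (z i)))
      ≤ 2 ^ n * (K * (capacity k M R * capacity l N T * B) * √(3 * (k + l - 1)) * √n) := by
  have hU := capacity_nonneg k M R
  have hU' := capacity_nonneg l N T
  have hkl : ((k + l - 1 : ℕ) : ℝ) = (k : ℝ) + l - 1 := by
    rw [Nat.cast_sub (by omega)]; push_cast; ring
  rw [← hkl]
  refine sum_le_of_forall_sum_exp_le hn (by omega) (by positivity) fun c hc => ?_
  have hb := abs_mul_sub_mul_le hg hc.le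
  obtain ⟨ρ', hρ'⟩ := exists_sum_exp_sign_le
    (fun _ : boundedDisc e k M × boundedGen q l (e 0) N => 0)
    (fun t i => c * g (logit e r k t.1 (generator q s l (e 0) t.2 (z i))))
    (fun t i => c * K * logit e r k t.1 (generator q s l (e 0) t.2 (z i)))
    (fun t i => by simpa [hg0] using hb (logit e r k t.1 (generator q s l (e 0) t.2 (z i))) 0)
    (fun t t' i => hb _ _) ρ
  obtain ⟨τ', hτ'⟩ := exists_sum_exp_logit_le hrLip hrHom
    (fun (θ : boundedGen q l (e 0) N) i => generator q s l (e 0) θ (z i)) (fun ε => (ρ' ε).2)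
    (fun ε => (ρ' ε).1.1) (fun ε => (ρ' ε).1.2) (c := c * K) (by positivity)
  obtain ⟨τ'', hτ''⟩ := exists_sum_exp_norm_generator_le hsLip hsHom
    (fun _ : Unit => z) (fun _ => ()) (fun ε => (τ' ε).1) (fun ε => (τ' ε).2)
    (c := c * K * capacity k M R) (by positivity)
  have h3 := sum_exp_norm_sum_sign_le hz (c := c * K * capacity k M R * capacity l N T)
    (by positivity)
  calc _ ≤ ∑ ε, Real.exp (c * K * ∑ i, boolSign (ε i) *
        logit e r k (ρ' ε).1 (generator q s l (e 0) (ρ' ε).2 (z i))) := by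
        refine le_trans (le_of_eq (Finset.sum_congr rfl fun ε _ => ?_))
          (hρ'.trans_eq (Finset.sum_congr rfl fun ε _ => ?_))
        · rw [zero_add, Finset.mul_sum]
          congr 1
          exact Finset.sum_congr rfl fun i _ => by ring
        · rw [zero_add, Finset.mul_sum]
          congr 1
          exact Finset.sum_congr rfl fun i _ => by ring
    _ ≤ _ := hτ'
    _ ≤ _ := mul_le_mul_of_nonneg_left
        (hτ''.trans (mul_le_mul_of_nonneg_left h3 (by positivity))) (by positivity)
    _ = 2 ^ n * (2 ^ (k - 1 + (l - 1) + 1) *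
        Real.exp ((c * K * capacity k M R * capacity l N T) ^ 2 * B ^ 2 * n / 2)) := by
        rw [pow_succ, pow_add]; ring
    _ = _ := by
        -- One factor `2` for each hidden layer of either network and one for the signed sum of
        -- inputs; the linear output layers cost nothing.
        rw [show k - 1 + (l - 1) + 1 = k + l - 1 by omega]
        congr 3
        ring

end Bounds

/-! ### McDiarmid's inequality -/

lemma integrable_of_abs_le {E : Type*} [MeasurableSpace E] {P : Measure E} [IsFiniteMeasure P]
    {f : E → ℝ} (hf : Measurable f) {C : ℝ} (hC : ∀ x, |f x| ≤ C) : Integrable f P :=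
  Integrable.of_bound hf.aestronglyMeasurable C (Filter.Eventually.of_forall hC)

lemma abs_integral_le_of_abs_le {E : Type*} [MeasurableSpace E] {P : Measure E}
    [IsProbabilityMeasure P] {f : E → ℝ} {C : ℝ} (hC : ∀ x, |f x| ≤ C) :
    |∫ x, f x ∂P| ≤ C := by
  simpa using norm_integral_le_of_norm_le_const (μ := P) (f := f) (C := C)
    (Filter.Eventually.of_forall hC)

lemma integrable_exp_of_abs_le {E : Type*} [MeasurableSpace E] {P : Measure E} [IsFiniteMeasure P]
    {f : E → ℝ} (hf : Measurable f) {C : ℝ} (hC : ∀ x, |f x| ≤ C) (t : ℝ) :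
    Integrable (fun x => Real.exp (t * f x)) P := by
  refine integrable_of_abs_le (C := Real.exp (|t| * C)) (by fun_prop) fun x => ?_
  rw [abs_of_pos (Real.exp_pos _), Real.exp_le_exp]
  calc _ ≤ |t * f x| := le_abs_self _
    _ = |t| * |f x| := abs_mul _ _
    _ ≤ _ := by gcongr; exact hC x

lemma measurable_fin_cons {E : Type*} [MeasurableSpace E] {n : ℕ} :
    Measurable fun p : E × (Fin n → E) => (Fin.cons p.1 p.2 : Fin (n + 1) → E) := by
  refine measurable_pi_lambda _ fun i => ?_
  refine Fin.cases ?_ (fun j => ?_) i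
  · simpa using measurable_fst
  · exact (measurable_pi_apply j).comp measurable_snd

lemma integral_pi_fin_succ {E : Type*} [MeasurableSpace E] (P : Measure E) [IsProbabilityMeasure P]
    {n : ℕ} {f : (Fin (n + 1) → E) → ℝ} (hf : Measurable f) {C : ℝ} (hC : ∀ x, |f x| ≤ C) :
    ∫ x, f x ∂(Measure.pi fun _ : Fin (n + 1) => P)
      = ∫ y, ∫ x, f (Fin.cons x y) ∂P ∂(Measure.pi fun _ : Fin n => P) := by
  have hmp := (measurePreserving_piFinSuccAbove (fun _ : Fin (n + 1) => P) 0).symm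
  have hm : Measurable fun p : E × (Fin n → E) => f (Fin.cons p.1 p.2) :=
    hf.comp measurable_fin_cons
  rw [← hmp.integral_comp', ← integral_prod_symm (fun p : E × (Fin n → E) => f (Fin.cons p.1 p.2))
    (integrable_of_abs_le hm fun p => hC _)]
  simp [MeasurableEquiv.piFinSuccAbove, Fin.insertNthEquiv]

/-- Hoeffding's lemma; the interval of length `c` starts at the infimum of `f`. -/
lemma integral_exp_le_of_abs_sub_le {E : Type*} [MeasurableSpace E] (P : Measure E)
    [IsProbabilityMeasure P] {f : E → ℝ} (hf : Measurable f) {C c : ℝ} (hC : ∀ x, |f x| ≤ C)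
    (hc : ∀ x y, |f x - f y| ≤ c) (t : ℝ) :
    ∫ x, Real.exp (t * f x) ∂P ≤ Real.exp (t * ∫ x, f x ∂P + c ^ 2 * t ^ 2 / 8) := by
  have : Nonempty E := nonempty_of_isProbabilityMeasure P
  have hbdd : BddBelow (Set.range f) := ⟨-C, by rintro _ ⟨x, rfl⟩; exact (abs_le.1 (hC x)).1⟩
  have hmem : ∀ x, f x ∈ Set.Icc (⨅ y, f y) ((⨅ y, f y) + c) := fun x => by
    refine ⟨ciInf_le hbdd x, ?_⟩
    have : f x - c ≤ ⨅ y, f y := le_ciInf fun y => by linarith [(abs_le.1 (hc x y)).2]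
    linarith
  have h := (hasSubgaussianMGF_of_mem_Icc (μ := P) hf.aemeasurable
    (Filter.Eventually.of_forall hmem)).mgf_le t
  have e : mgf (fun x => f x - ∫ x, f x ∂P) P t
      = Real.exp (-(t * ∫ x, f x ∂P)) * ∫ x, Real.exp (t * f x) ∂P := by
    rw [mgf, ← integral_const_mul]
    congr 1
    funext x
    rw [← Real.exp_add]
    ring_nf
  rw [e, Real.exp_neg, inv_mul_le_iff₀ (Real.exp_pos _), ← Real.exp_add] at h
  refine h.trans (Real.exp_le_exp.2 (le_of_eq ?_))
  simp [div_pow]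
  ring

/-- Integrate out one coordinate at a time: Hoeffding's lemma for the slice costs `c² t² / 8`, and
the averaged function inherits the bounded differences. -/
lemma integral_exp_le_of_bounded_differences {E : Type*} [MeasurableSpace E] (P : Measure E)
    [IsProbabilityMeasure P] {n : ℕ} {f : (Fin n → E) → ℝ} (hf : Measurable f) {C c : ℝ}
    (hC : ∀ x, |f x| ≤ C) (hc : ∀ i x y, (∀ j, j ≠ i → x j = y j) → |f x - f y| ≤ c) (t : ℝ) :
    ∫ x, Real.exp (t * f x) ∂(Measure.pi fun _ : Fin n => P)
      ≤ Real.exp (t * ∫ x, f x ∂(Measure.pi fun _ : Fin n => P) + n * (c ^ 2 * t ^ 2 / 8)) := by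
  induction n with
  | zero =>
    obtain ⟨v, rfl⟩ : ∃ v, f = fun _ => v :=
      ⟨f default, funext fun x => congrArg f (Subsingleton.elim _ _)⟩
    simp
  | succ n ih =>
    have hm : Measurable fun p : E × (Fin n → E) => f (Fin.cons p.1 p.2) :=
      hf.comp measurable_fin_cons
    have hmy : ∀ y : Fin n → E, Measurable fun x => f (Fin.cons x y) := fun y =>
      hm.comp (measurable_id.prodMk measurable_const)
    set g : (Fin n → E) → ℝ := fun y => ∫ x, f (Fin.cons x y) ∂P with hg
    have hgm : Measurable g := (hm.stronglyMeasurable.integral_prod_left').measurable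
    have hgC : ∀ y, |g y| ≤ C := fun y => abs_integral_le_of_abs_le fun x => hC _
    have hgc : ∀ i x y, (∀ j, j ≠ i → x j = y j) → |g x - g y| ≤ c := by
      intro i x y hxy
      rw [hg]
      simp only
      rw [← integral_sub (integrable_of_abs_le (hmy x) fun _ => hC _)
        (integrable_of_abs_le (hmy y) fun _ => hC _)]
      refine abs_integral_le_of_abs_le fun z => hc i.succ _ _ fun j hj => ?_
      induction j using Fin.cases with
      | zero => simp
      | succ j => simpa using hxy j (by rintro rfl; exact hj rfl)
    have hexp : ∀ x, |Real.exp (t * f x)| ≤ Real.exp (|t| * C) := fun x => by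
      rw [abs_of_pos (Real.exp_pos _), Real.exp_le_exp]
      calc _ ≤ |t * f x| := le_abs_self _
        _ = |t| * |f x| := abs_mul _ _
        _ ≤ _ := by gcongr; exact hC x
    rw [integral_pi_fin_succ P (f := fun x => Real.exp (t * f x)) (by fun_prop) hexp,
      integral_pi_fin_succ P hf hC]
    have hme : Measurable fun p : E × (Fin n → E) => Real.exp (t * f (Fin.cons p.1 p.2)) :=
      Real.measurable_exp.comp (hm.const_mul t)
    calc _ ≤ ∫ y, Real.exp (t * g y) * Real.exp (c ^ 2 * t ^ 2 / 8)
            ∂(Measure.pi fun _ : Fin n => P) := by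
          refine integral_mono ?_ ((integrable_exp_of_abs_le hgm hgC t).mul_const _) fun y => ?_
          · exact integrable_of_abs_le
              (hme.stronglyMeasurable.integral_prod_left').measurable
              fun y => abs_integral_le_of_abs_le fun x => hexp _
          · rw [← Real.exp_add]
            refine integral_exp_le_of_abs_sub_le P (hmy y) (fun _ => hC _) (fun x x' => ?_) t
            refine hc 0 _ _ fun j hj => ?_
            induction j using Fin.cases with
            | zero => exact absurd rfl hj
            | succ j => simp
      _ ≤ Real.exp (t * ∫ y, g y ∂(Measure.pi fun _ : Fin n => P) + n * (c ^ 2 * t ^ 2 / 8))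
            * Real.exp (c ^ 2 * t ^ 2 / 8) := by
          rw [integral_mul_const]
          exact mul_le_mul_of_nonneg_right (ih hgm hgC hgc) (Real.exp_pos _).le
      _ = _ := by
          rw [← Real.exp_add]
          simp only [← hg]
          push_cast
          ring_nf

/-- **McDiarmid's inequality**. -/
lemma measureReal_pi_ge_le_of_bounded_differences {E : Type*} [MeasurableSpace E] (P : Measure E)
    [IsProbabilityMeasure P] {n : ℕ} {f : (Fin n → E) → ℝ} (hf : Measurable f) {C c : ℝ}
    (hC : ∀ x, |f x| ≤ C) (hc : ∀ i x y, (∀ j, j ≠ i → x j = y j) → |f x - f y| ≤ c)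
    {s : ℝ} (hs : 0 ≤ s) :
    (Measure.pi fun _ : Fin n => P).real
        {x | s ≤ f x - ∫ y, f y ∂(Measure.pi fun _ : Fin n => P)}
      ≤ Real.exp (-s ^ 2 / (2 * (n * c ^ 2 / 4))) := by
  set I := ∫ y, f y ∂(Measure.pi fun _ : Fin n => P) with hI
  obtain ⟨v, hv⟩ : ∃ v : ℝ≥0, (v : ℝ) = n * c ^ 2 / 4 :=
    ⟨Real.toNNReal _, Real.coe_toNNReal _ (by positivity)⟩
  have hsub : HasSubgaussianMGF (fun x => f x - I) v
      (Measure.pi fun _ : Fin n => P) := by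
    have e : ∀ t x, Real.exp (t * (f x - I)) = Real.exp (-(t * I)) * Real.exp (t * f x) := by
      intro t x
      rw [← Real.exp_add]
      ring_nf
    refine ⟨fun t => ?_, fun t => ?_⟩
    · simp only [e]
      exact (integrable_exp_of_abs_le hf hC t).const_mul _
    · rw [mgf]
      simp only [e]
      rw [integral_const_mul, Real.exp_neg, inv_mul_le_iff₀ (Real.exp_pos _), ← Real.exp_add]
      refine (integral_exp_le_of_bounded_differences P hf hC hc t).trans
        (Real.exp_le_exp.2 (le_of_eq ?_))
      rw [hv]
      ring
  rw [← hv]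
  exact hsub.measure_ge_le hs

/-! ### Symmetrization and uniform deviations -/

lemma abs_ciSup_le {κ : Type*} [Nonempty κ] {f : κ → ℝ} {C : ℝ} (hf : ∀ i, |f i| ≤ C) :
    |⨆ i, f i| ≤ C := by
  refine abs_le.2 ⟨?_, ciSup_le fun i => (abs_le.1 (hf i)).2⟩
  obtain ⟨i⟩ := ‹Nonempty κ›
  exact (abs_le.1 (hf i)).1.trans
    (le_ciSup (f := f) ⟨C, by rintro _ ⟨j, rfl⟩; exact (abs_le.1 (hf j)).2⟩ i)

lemma bddAbove_range_of_abs_le {κ : Type*} {f : κ → ℝ} {C : ℝ} (hf : ∀ i, |f i| ≤ C) :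
    BddAbove (Set.range f) :=
  ⟨C, by rintro _ ⟨j, rfl⟩; exact (abs_le.1 (hf j)).2⟩

lemma abs_sum_sign_mul_le {E ι : Type*} {n : ℕ} {h : ι → E → ℝ} {b : ℝ}
    (hb : ∀ i x, |h i x| ≤ b) {s : Fin n → ℝ} (hs : ∀ j, |s j| = 1)
    (x : Fin n → E) (i : ι) : |∑ j, s j * h i (x j)| ≤ n * b := by
  refine (Finset.abs_sum_le_sum_abs _ _).trans ((Finset.sum_le_sum fun j _ =>
    (show |s j * h i (x j)| ≤ b by rw [abs_mul, hs, one_mul]; exact hb _ _)).trans_eq (by simp))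

/-- Passage from selections back to suprema: choose a near-maximizer for each `ε`. -/
lemma sum_ciSup_le_of_forall_selection {κ ι : Type*} [Fintype κ] [Nonempty ι] {F : κ → ι → ℝ}
    {C : ℝ} (hF : ∀ τ : κ → ι, ∑ ε, F ε (τ ε) ≤ C) : ∑ ε, ⨆ i, F ε i ≤ C := by
  refine le_of_forall_pos_le_add fun η hη => ?_
  have hcard : (0 : ℝ) < Fintype.card κ + 1 := by positivity
  -- The `+ 1` keeps the slack meaningful for empty `κ`.
  have hη' : 0 < η / (Fintype.card κ + 1) := by positivity
  choose τ hτ using fun ε => exists_lt_of_lt_ciSup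
    (sub_lt_self (⨆ i, F ε i) hη')
  have h1 := (Finset.sum_le_sum fun ε (_ : ε ∈ Finset.univ) => (hτ ε).le).trans (hF τ)
  rw [Finset.sum_sub_distrib, Finset.sum_const, Finset.card_univ, nsmul_eq_mul] at h1
  have h2 : Fintype.card κ * (η / (Fintype.card κ + 1)) ≤ η := by
    rw [mul_div_assoc', div_le_iff₀ hcard]
    nlinarith
  linarith

section Symmetrization

variable {E : Type*} [MeasurableSpace E] {P : Measure E} [IsProbabilityMeasure P] {n : ℕ}
  {ι : Type*} {h : ι → E → ℝ} {b : ℝ}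

lemma measurable_sum_sign_mul (hm : ∀ i, Measurable (h i)) (s : Fin n → ℝ) (i : ι) :
    Measurable fun x : Fin n → E => ∑ j, s j * h i (x j) :=
  Finset.measurable_sum _ fun j _ => ((hm i).comp (measurable_pi_apply j)).const_mul _

/-- Symmetrization with a ghost sample. Countability makes the suprema measurable; the Rademacher
bound is needed only almost everywhere, thus only for samples in the support. -/
lemma integral_iSup_sub_le [Countable ι] [Nonempty ι] (hm : ∀ i, Measurable (h i))
    (hb : ∀ i x, |h i x| ≤ b) {ρ : ℝ}
    (hρ : ∀ᵐ x ∂(Measure.pi fun _ : Fin n => P), ∀ τ : (Fin n → Bool) → ι,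
      ∑ ε, ∑ j, boolSign (ε j) * h (τ ε) (x j) ≤ 2 ^ n * ρ) :
    ∫ x, ⨆ i, (n * ∫ y, h i y ∂P - ∑ j, h i (x j)) ∂(Measure.pi fun _ : Fin n => P)
      ≤ 2 * ρ := by
  set π := Measure.pi fun _ : Fin n => P with hπ
  set π₂ := Measure.pi fun _ : Fin n => P.prod P with hπ₂
  let Ψ : (Fin n → ℝ) → (Fin n → E) → ℝ := fun s x => ⨆ i, ∑ j, s j * h i (x j)
  let D : (Fin n → ℝ) → (Fin n → E × E) → ℝ := fun s p =>
    ⨆ i, ∑ j, s j * (h i (p j).2 - h i (p j).1)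
  have hΨm : ∀ s, Measurable (Ψ s) := fun s =>
    Measurable.iSup fun i => measurable_sum_sign_mul hm s i
  have hΨb : ∀ s : Fin n → ℝ, (∀ j, |s j| = 1) → ∀ x, |Ψ s x| ≤ n * b := fun s hs x =>
    abs_ciSup_le fun i => abs_sum_sign_mul_le hb hs x i
  have hh2 : ∀ i (p : E × E), |h i p.2 - h i p.1| ≤ 2 * b := fun i p => by
    refine (abs_sub _ _).trans ?_
    linarith [hb i p.1, hb i p.2]
  have hm2 : ∀ i, Measurable fun p : E × E => h i p.2 - h i p.1 := fun i =>
    ((hm i).comp measurable_snd).sub ((hm i).comp measurable_fst)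
  have hDm : ∀ s, Measurable (D s) := fun s =>
    Measurable.iSup fun i => measurable_sum_sign_mul
      (h := fun i (p : E × E) => h i p.2 - h i p.1) hm2 s i
  have hDb : ∀ s : Fin n → ℝ, (∀ j, |s j| = 1) → ∀ x, |D s x| ≤ n * (2 * b) := fun s hs x =>
    abs_ciSup_le fun i => abs_sum_sign_mul_le
      (h := fun i (p : E × E) => h i p.2 - h i p.1) hh2 hs x i
  have hΨi : ∀ s : Fin n → ℝ, (∀ j, |s j| = 1) → Integrable (Ψ s) π := fun s hs =>
    integrable_of_abs_le (hΨm s) (hΨb s hs)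
  have hDi : ∀ s : Fin n → ℝ, (∀ j, |s j| = 1) → Integrable (D s) π₂ := fun s hs =>
    integrable_of_abs_le (hDm s) (hDb s hs)
  have one : ∀ j : Fin n, |(1 : ℝ)| = 1 := fun _ => abs_one
  have hsgn : ∀ ε : Fin n → Bool, ∀ j, |boolSign (ε j)| = 1 := fun ε j => abs_boolSign _
  have hsgn' : ∀ ε : Fin n → Bool, ∀ j, |(-boolSign (ε j))| = 1 := fun ε j => by
    rw [abs_neg, abs_boolSign]
  -- ghost sample
  have ghost : ∫ x, ⨆ i, (n * ∫ y, h i y ∂P - ∑ j, h i (x j)) ∂π ≤ ∫ p, D (fun _ => 1) p ∂π₂ := by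
    have hmp := (measurePreserving_arrowProdEquivProdArrow E E (Fin n) (fun _ => P)
      (fun _ => P)).symm
    rw [← hmp.integral_comp', integral_prod]
    · have hDm' : Measurable fun p : (Fin n → E) × (Fin n → E) =>
          D (fun _ => 1) ((MeasurableEquiv.arrowProdEquivProdArrow E E (Fin n)).symm p) :=
        (hDm _).comp (MeasurableEquiv.measurable _)
      refine integral_mono ?_ ?_ fun x => ciSup_le fun i => ?_
      · refine integrable_of_abs_le (C := n * (2 * b)) (Measurable.iSup fun i => ?_) fun x =>
          abs_ciSup_le fun i => ?_
        · exact measurable_const.sub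
            (Finset.measurable_sum _ fun j _ => (hm i).comp (measurable_pi_apply j))
        · have h1 : |∫ y, h i y ∂P| ≤ b := abs_integral_le_of_abs_le (hb i)
          have h2 := abs_sum_sign_mul_le hb one x i
          simp only [one_mul] at h2
          refine (abs_sub _ _).trans ?_
          rw [abs_mul, Nat.abs_cast]
          nlinarith [Nat.cast_nonneg (α := ℝ) n]
      · exact integrable_of_abs_le
          (hDm'.stronglyMeasurable.integral_prod_right').measurable
          fun x => abs_integral_le_of_abs_le fun y => hDb _ one _
      · have e : n * ∫ y, h i y ∂P - ∑ j, h i (x j)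
            = ∫ y : Fin n → E, ∑ j, (h i (y j) - h i (x j)) ∂π := by
          rw [integral_finsetSum]
          · have : ∀ j : Fin n, ∫ y : Fin n → E, (h i (y j) - h i (x j)) ∂π
                = ∫ y, h i y ∂P - h i (x j) := by
              intro j
              have hmpj := measurePreserving_eval (fun _ : Fin n => P) j
              have e1 : ∫ y : Fin n → E, h i (y j) ∂π = ∫ y, h i y ∂P := by
                rw [← hmpj.map_eq, integral_map hmpj.aemeasurable
                  (hm i).aestronglyMeasurable]
              rw [integral_sub, e1]
              · simp
              · exact integrable_of_abs_le ((hm i).comp (measurable_pi_apply j)) fun y => hb i _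
              · exact integrable_const _
            simp only [this, Finset.sum_sub_distrib]
            simp
          · intro j _
            exact integrable_of_abs_le (C := 2 * b)
              (((hm i).comp (measurable_pi_apply j)).sub measurable_const)
              fun y => hh2 i (x j, y j)
        rw [e]
        refine integral_mono (integrable_of_abs_le (C := n * (2 * b)) ?_ fun y => ?_)
          (integrable_of_abs_le (hDm'.comp (measurable_const.prodMk measurable_id))
            fun y => hDb _ one _) fun y => ?_
        · exact Finset.measurable_sum _ fun j _ =>
            ((hm i).comp (measurable_pi_apply j)).sub measurable_const
        · simpa using abs_sum_sign_mul_le (h := fun i (p : E × E) => h i p.2 - h i p.1) hh2 one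
            (fun j => (x j, y j)) i
        · have := le_ciSup (bddAbove_range_of_abs_le fun i => abs_sum_sign_mul_le
            (h := fun i (p : E × E) => h i p.2 - h i p.1) hh2 one (fun j => (x j, y j)) i) i
          simp only [one_mul] at this
          simpa [D, MeasurableEquiv.arrowProdEquivProdArrow] using this
    · exact integrable_of_abs_le ((hDm _).comp (MeasurableEquiv.measurable _))
        fun y => hDb _ one _
  -- exchangeability of the pairs
  have swap : ∀ ε : Fin n → Bool, ∫ p, D (fun _ => 1) p ∂π₂
      = ∫ p, D (fun j => boolSign (ε j)) p ∂π₂ := by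
    intro ε
    -- Exchanging sample and ghost sample in the coordinates of sign `-1` preserves the law and
    -- multiplies the corresponding differences by `-1`.
    let sw : Fin n → E × E → E × E := fun j => cond (ε j) id Prod.swap
    have hsw : MeasurePreserving (fun p : Fin n → E × E => fun j => sw j (p j)) π₂ π₂ := by
      refine measurePreserving_pi _ _ fun j => ?_
      simp only [sw]
      cases ε j
      · exact Measure.measurePreserving_swap
      · exact MeasurePreserving.id _
    conv_lhs => rw [← hsw.map_eq]
    rw [integral_map hsw.aemeasurable (hDm _).aestronglyMeasurable]
    congr 1
    funext p
    simp only [D, sw]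
    congr 1
    funext i
    refine Finset.sum_congr rfl fun j _ => ?_
    cases ε j <;> simp
  have split : ∀ ε : Fin n → Bool, ∫ p, D (fun j => boolSign (ε j)) p ∂π₂
      ≤ ∫ x, Ψ (fun j => boolSign (ε j)) x ∂π + ∫ x, Ψ (fun j => -boolSign (ε j)) x ∂π := by
    intro ε
    have hmp1 : MeasurePreserving (fun p : Fin n → E × E => fun j => (p j).1) π₂ π :=
      measurePreserving_pi _ _ fun j => measurePreserving_fst
    have hmp2 : MeasurePreserving (fun p : Fin n → E × E => fun j => (p j).2) π₂ π :=
      measurePreserving_pi _ _ fun j => measurePreserving_snd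
    have e1 : ∫ x, Ψ (fun j => -boolSign (ε j)) x ∂π
        = ∫ p : Fin n → E × E, Ψ (fun j => -boolSign (ε j)) (fun j => (p j).1) ∂π₂ := by
      rw [← hmp1.map_eq, integral_map hmp1.aemeasurable (hΨm _).aestronglyMeasurable]
    have e2 : ∫ x, Ψ (fun j => boolSign (ε j)) x ∂π
        = ∫ p : Fin n → E × E, Ψ (fun j => boolSign (ε j)) (fun j => (p j).2) ∂π₂ := by
      rw [← hmp2.map_eq, integral_map hmp2.aemeasurable (hΨm _).aestronglyMeasurable]
    have i1 := hmp1.integrable_comp_of_integrable (hΨi _ (hsgn' ε))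
    have i2 := hmp2.integrable_comp_of_integrable (hΨi _ (hsgn ε))
    rw [e1, e2, ← integral_add (by exact i2) (by exact i1)]
    refine integral_mono (hDi _ (hsgn ε)) (i2.add i1) fun p => ciSup_le fun i => ?_
    have b1 := le_ciSup (bddAbove_range_of_abs_le fun i =>
      abs_sum_sign_mul_le hb (hsgn' ε) (fun j => (p j).1) i) i
    have b2 := le_ciSup (bddAbove_range_of_abs_le fun i =>
      abs_sum_sign_mul_le hb (hsgn ε) (fun j => (p j).2) i) i
    refine le_trans (le_of_eq ?_) (add_le_add b2 b1)
    rw [← Finset.sum_add_distrib]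
    exact Finset.sum_congr rfl fun j _ => by ring
  have rad : ∑ ε : Fin n → Bool, ∫ x, Ψ (fun j => boolSign (ε j)) x ∂π ≤ 2 ^ n * ρ := by
    rw [← integral_finsetSum _ fun ε _ => hΨi _ (hsgn ε)]
    refine (integral_mono_ae (integrable_finsetSum _ fun ε _ => hΨi _ (hsgn ε))
      (integrable_const (2 ^ n * ρ)) ?_).trans_eq (by simp)
    filter_upwards [hρ] with x hx
    exact sum_ciSup_le_of_forall_selection fun τ => hx τ
  have rad_neg : ∑ ε : Fin n → Bool, ∫ x, Ψ (fun j => -boolSign (ε j)) x ∂π ≤ 2 ^ n * ρ := by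
    rw [← sum_bool_neg]
    simpa only [boolSign_not, neg_neg] using rad
  refine ghost.trans ?_
  have h6 : (2 : ℝ) ^ n * ∫ p, D (fun _ => 1) p ∂π₂ ≤ 2 ^ n * (2 * ρ) := by
    calc (2 : ℝ) ^ n * ∫ p, D (fun _ => 1) p ∂π₂
        = ∑ ε : Fin n → Bool, ∫ p, D (fun _ => 1) p ∂π₂ := by simp
      _ ≤ ∑ ε : Fin n → Bool, (∫ x, Ψ (fun j => boolSign (ε j)) x ∂π
            + ∫ x, Ψ (fun j => -boolSign (ε j)) x ∂π) :=
          Finset.sum_le_sum fun ε _ => (swap ε).trans_le (split ε)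
      _ ≤ 2 ^ n * (2 * ρ) := by
          rw [Finset.sum_add_distrib]
          linarith
  exact le_of_mul_le_mul_left h6 (by positivity)

/-- Uniform one-sided deviation of empirical means over a countable bounded class. -/
lemma exists_measurableSet_forall_deviation_le_of_countable {S : Type*} [MeasurableSpace S]
    {μ : Measure S} [IsProbabilityMeasure μ] [Countable ι] [Nonempty ι]
    (hm : ∀ i, Measurable (h i)) (hb : ∀ i x, |h i x| ≤ b) (hn : 1 ≤ n)
    {X : Fin n → S → E} (hX : ∀ j, Measurable (X j)) (hlaw : ∀ j, μ.map (X j) = P)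
    (hind : iIndepFun X μ) {ρ : ℝ}
    (hρ : ∀ᵐ x ∂(Measure.pi fun _ : Fin n => P), ∀ τ : (Fin n → Bool) → ι,
      ∑ ε, ∑ j, boolSign (ε j) * h (τ ε) (x j) ≤ 2 ^ n * ρ)
    {δ : ℝ} (hδ : 0 < δ) (hδ1 : δ < 1) :
    ∃ A : Set S, MeasurableSet A ∧ 1 - δ ≤ μ.real A ∧ ∀ a ∈ A, ∀ i,
      n * ∫ y, h i y ∂P - ∑ j, h i (X j a) ≤ 2 * ρ + b * √(2 * n * Real.log (1 / δ)) := by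
  have hn' : (0 : ℝ) < n := by exact_mod_cast hn
  have hb0 : 0 ≤ b := by
    obtain ⟨i⟩ := ‹Nonempty ι›
    obtain ⟨x⟩ := nonempty_of_isProbabilityMeasure P
    exact (abs_nonneg _).trans (hb i x)
  set π := Measure.pi fun _ : Fin n => P with hπ
  let f : (Fin n → E) → ℝ := fun x => ⨆ i, (n * ∫ y, h i y ∂P - ∑ j, h i (x j))
  have hint := integral_iSup_sub_le (P := P) hm hb hρ
  have habs : ∀ (x : Fin n → E) i, |n * ∫ y, h i y ∂P - ∑ j : Fin n, h i (x j)| ≤ n * (2 * b) := by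
    intro x i
    have h1 : |∫ y, h i y ∂P| ≤ b := abs_integral_le_of_abs_le (hb i)
    have h2 := abs_sum_sign_mul_le hb (s := fun _ : Fin n => 1) (fun _ => abs_one) x i
    simp only [one_mul] at h2
    refine (abs_sub _ _).trans ?_
    rw [abs_mul, Nat.abs_cast]
    nlinarith
  have hfm : Measurable f := Measurable.iSup fun i => measurable_const.sub
    (Finset.measurable_sum _ fun j _ => (hm i).comp (measurable_pi_apply j))
  have hle : ∀ x i, n * ∫ y, h i y ∂P - ∑ j : Fin n, h i (x j) ≤ f x := fun x i =>
    le_ciSup (bddAbove_range_of_abs_le (habs x)) i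
  -- For `b = 0` the class is zero and the McDiarmid exponent degenerates.
  rcases hb0.eq_or_lt with rfl | hbpos
  · refine ⟨Set.univ, MeasurableSet.univ, by simp [hδ.le], fun a _ i => ?_⟩
    have h0 : ∀ i x, h i x = 0 := fun i x => abs_nonpos_iff.1 (hb i x)
    simp only [h0, integral_zero, Finset.sum_const_zero, mul_zero, sub_zero, zero_mul,
      ciSup_const] at hint ⊢
    linarith
  have hdiff : ∀ i x y, (∀ j, j ≠ i → x j = y j) → |f x - f y| ≤ 2 * b := by
    have key : ∀ i x y, (∀ j, j ≠ i → x j = y j) → f x ≤ f y + 2 * b := by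
      intro i x y hxy
      refine ciSup_le fun t => ?_
      have h1 := hle y t
      have h2 : ∑ j, h t (y j) - ∑ j, h t (x j) ≤ 2 * b := by
        rw [← Finset.sum_sub_distrib, Finset.sum_eq_single i]
        · linarith [(abs_le.1 (hb t (y i))).2, (abs_le.1 (hb t (x i))).1]
        · intro j _ hj
          rw [hxy j hj, sub_self]
        · simp
      linarith
    intro i x y hxy
    rw [abs_le]
    constructor
    · linarith [key i y x fun j hj => (hxy j hj).symm]
    · linarith [key i x y hxy]
  have hlog : 0 < Real.log (1 / δ) := Real.log_pos (by rw [one_div]; exact (one_lt_inv₀ hδ).2 hδ1)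
  -- Changing one sample point moves the supremum by at most `2 * b`; this `s` makes the McDiarmid
  -- tail exactly `δ`.
  set s := b * √(2 * n * Real.log (1 / δ)) with hs
  have hmc := measureReal_pi_ge_le_of_bounded_differences P hfm
    (fun x => abs_ciSup_le (habs x)) hdiff (s := s) (by positivity)
  have hexp : Real.exp (-s ^ 2 / (2 * (n * (2 * b) ^ 2 / 4))) = δ := by
    have : -s ^ 2 / (2 * (n * (2 * b) ^ 2 / 4)) = -Real.log (1 / δ) := by
      rw [hs, mul_pow, Real.sq_sqrt (by positivity)]
      field_simp
      ring
    rw [this, one_div, Real.log_inv, neg_neg, Real.exp_log hδ]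
  rw [hexp] at hmc
  have hXm : Measurable fun a j => X j a := measurable_pi_lambda _ hX
  have hmap : μ.map (fun a j => X j a) = π := by
    rw [(iIndepFun_iff_map_fun_eq_pi_map fun j => (hX j).aemeasurable).1 hind]
    simp only [hlaw, hπ]
  set I := ∫ y, f y ∂π with hI
  have hBm : MeasurableSet {x : Fin n → E | s ≤ f x - I} :=
    measurableSet_le measurable_const (hfm.sub measurable_const)
  refine ⟨((fun a j => X j a) ⁻¹' {x | s ≤ f x - I})ᶜ, (hXm hBm).compl, ?_, fun a ha i => ?_⟩
  · rw [probReal_compl_eq_one_sub (hXm hBm), ← map_measureReal_apply hXm hBm, hmap]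
    linarith
  · have h1 : f (fun j => X j a) - I < s := by simpa using ha
    have h2 := hle (fun j => X j a) i
    have h3 : I ≤ 2 * ρ := hint
    linarith

/-- Uniform one-sided deviation of empirical means over a bounded class which depends continuously
on a parameter in a separable space. -/
lemma exists_measurableSet_forall_deviation_le {S : Type*} [MeasurableSpace S]
    {μ : Measure S} [IsProbabilityMeasure μ] [TopologicalSpace ι] [SecondCountableTopology ι]
    [Nonempty ι] (hm : ∀ i, Measurable (h i)) (hcont : ∀ x, Continuous fun i => h i x)
    (hb : ∀ i x, |h i x| ≤ b) (hn : 1 ≤ n)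
    {X : Fin n → S → E} (hX : ∀ j, Measurable (X j)) (hlaw : ∀ j, μ.map (X j) = P)
    (hind : iIndepFun X μ) {ρ : ℝ}
    (hρ : ∀ᵐ x ∂(Measure.pi fun _ : Fin n => P), ∀ τ : (Fin n → Bool) → ι,
      ∑ ε, ∑ j, boolSign (ε j) * h (τ ε) (x j) ≤ 2 ^ n * ρ)
    {δ : ℝ} (hδ : 0 < δ) (hδ1 : δ < 1) :
    ∃ A : Set S, MeasurableSet A ∧ 1 - δ ≤ μ.real A ∧ ∀ a ∈ A, ∀ i,
      n * ∫ y, h i y ∂P - ∑ j, h i (X j a) ≤ 2 * ρ + b * √(2 * n * Real.log (1 / δ)) := by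
  -- The deviation is continuous in the parameter, by dominated convergence for the mean, so a
  -- countable dense set suffices.
  let u := TopologicalSpace.denseSeq ι
  obtain ⟨A, hA, hA1, hA2⟩ := exists_measurableSet_forall_deviation_le_of_countable
    (h := fun k => h (u k)) (fun k => hm _) (fun k => hb _) hn hX hlaw hind
    (hρ.mono fun x hx τ => hx fun ε => u (τ ε)) hδ hδ1
  refine ⟨A, hA, hA1, fun a ha i => ?_⟩
  have hcI : Continuous fun i => ∫ y, h i y ∂P :=
    continuous_of_dominated (bound := fun _ => b) (fun i => (hm i).aestronglyMeasurable)
      (fun i => Filter.Eventually.of_forall (hb i)) (integrable_const _)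
      (Filter.Eventually.of_forall hcont)
  have hc : Continuous fun i => n * ∫ y, h i y ∂P - ∑ j, h i (X j a) :=
    (continuous_const.mul hcI).sub (continuous_finsetSum _ fun j _ => hcont _)
  exact (TopologicalSpace.denseRange_denseSeq ι).induction_on
    (p := fun i => n * ∫ y, h i y ∂P - ∑ j, h i (X j a) ≤ _) i
    (isClosed_le hc continuous_const) fun k => hA2 a ha k

end Symmetrization

/-- Two-sided uniform deviations: a Rademacher bound for a bounded class `F` controls the
difference of the deviations of any two members of the class with high probability. -/
lemma exists_measurableSet_forall_deviation_pair_le {S E ι : Type*} [MeasurableSpace S]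
    {μ : Measure S} [IsProbabilityMeasure μ] [MeasurableSpace E] {P : Measure E}
    [IsProbabilityMeasure P] [TopologicalSpace ι] [SecondCountableTopology ι] [Nonempty ι]
    {F : ι → E → ℝ} (hm : ∀ i, Measurable (F i)) (hcont : ∀ x, Continuous fun i => F i x)
    {β κ : ℝ} (hb : ∀ i x, |F i x| ≤ β) {n : ℕ} (hn : 1 ≤ n)
    {X : Fin n → S → E} (hX : ∀ j, Measurable (X j)) (hlaw : ∀ j, μ.map (X j) = P)
    (hind : iIndepFun X μ) {B : Set E} (hB : ∀ᵐ x ∂P, x ∈ B)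
    (hρ : ∀ x : Fin n → E, (∀ j, x j ∈ B) → ∀ τ : (Fin n → Bool) → ι,
      ∑ ε, ∑ j, boolSign (ε j) * F (τ ε) (x j) ≤ 2 ^ n * (β * κ * √n))
    {δ : ℝ} (hδ : 0 < δ) (hδ1 : δ < 1) :
    ∃ A : Set S, MeasurableSet A ∧ 1 - δ ≤ μ.real A ∧ ∀ a ∈ A, (∀ j, X j a ∈ B) ∧ ∀ i i',
      (∫ y, F i y ∂P - (n : ℝ)⁻¹ * ∑ j, F i (X j a))
        + ((n : ℝ)⁻¹ * ∑ j, F i' (X j a) - ∫ y, F i' y ∂P)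
      ≤ 4 * β * κ / √n + √(Real.log (1 / δ)) * (4 * β / √(2 * n)) := by
  have hn' : (0 : ℝ) < n := by exact_mod_cast hn
  have hae : ∀ᵐ x ∂(Measure.pi fun _ : Fin n => P), ∀ j, x j ∈ B :=
    ae_all_iff.2 fun j => (Measure.tendsto_eval_ae_ae (μ := fun _ : Fin n => P) (i := j)) hB
  obtain ⟨A, hA, hA1, hA2⟩ := exists_measurableSet_forall_deviation_le (μ := μ) (P := P)
    (h := fun (p : ι × ι) x => F p.1 x - F p.2 x) (b := 2 * β) (ρ := 2 * (β * κ * √n))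
    (fun p => (hm _).sub (hm _))
    (fun x => ((hcont x).comp continuous_fst).sub ((hcont x).comp continuous_snd))
    (fun p x => (abs_sub _ _).trans (by linarith [hb p.1 x, hb p.2 x])) hn hX hlaw hind
    (by
      filter_upwards [hae] with x hx τ
      have h1 := hρ x hx fun ε => (τ ε).1
      -- The second member carries a minus sign, absorbed by flipping all signs; the pair class has
      -- twice the Rademacher bound.
      have h2 := hρ x hx fun ε => (τ fun j => !(ε j)).2
      rw [← sum_bool_neg] at h2
      simp only [boolSign_not, Bool.not_not, neg_mul, Finset.sum_neg_distrib] at h2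
      simp only [mul_sub, Finset.sum_sub_distrib]
      linarith) hδ hδ1
  have hXB : ∀ᵐ a ∂μ, ∀ j, X j a ∈ B := ae_all_iff.2 fun j =>
    ae_of_ae_map (hX j).aemeasurable (by rw [hlaw j]; exact hB)
  -- Intersecting with this event of full measure puts the sample in `B` at no cost in probability.
  obtain ⟨A', hA'ae, hA'm, hA'⟩ := hXB.exists_measurable_mem
  refine ⟨A ∩ A', hA.inter hA'm, ?_, fun a ha => ⟨hA' a ha.2, fun i i' => ?_⟩⟩
  · have : (A ∩ A' : Set S) =ᵐ[μ] A := by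
      filter_upwards [hA'ae] with a ha
      exact propext ⟨fun h => h.1, fun h => ⟨h, ha⟩⟩
    rwa [measureReal_congr this]
  · have h := hA2 a ha.1 (i, i')
    have hint : ∀ i, Integrable (F i) P := fun i => integrable_of_abs_le (hm i) (hb i)
    simp only [Finset.sum_sub_distrib] at h
    rw [integral_sub (hint i) (hint i')] at h
    have e1 : (n : ℝ) * (4 * β * κ / √n) = 2 * (2 * (β * κ * √n)) := by
      have : (n : ℝ) = √n * √n := (Real.mul_self_sqrt hn'.le).symm
      rw [mul_div_assoc', div_eq_iff (by positivity)]
      rw [this]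
      simp only [Real.sqrt_mul_self (Real.sqrt_nonneg (n : ℝ))]
      ring
    have e2 : (n : ℝ) * (√(Real.log (1 / δ)) * (4 * β / √(2 * n)))
        = 2 * β * √(2 * n * Real.log (1 / δ)) := by
      have h2n : (2 * n : ℝ) = √(2 * n) * √(2 * n) := (Real.mul_self_sqrt (by positivity)).symm
      rw [mul_div_assoc', mul_div_assoc', div_eq_iff (by positivity),
        Real.sqrt_mul (by positivity : (0 : ℝ) ≤ 2 * n)]
      linear_combination (2 * β * √(Real.log (1 / δ))) * h2n
    refine le_of_mul_le_mul_left ?_ hn'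
    rw [mul_add, mul_add, e1, e2, mul_sub, mul_sub, mul_inv_cancel_left₀ hn'.ne',
      mul_inv_cancel_left₀ hn'.ne']
    linarith

/-! ### Error decomposition and clamping -/

/-- The error decomposition for minimizers of an empirical supremum. -/
lemma iSup_sub_iInf_iSup_le_of_minimizer {Ω Θ : Type*} [Nonempty Ω] [Nonempty Θ]
    {a a' : Ω → ℝ} {b b' : Ω → Θ → ℝ} {C C' EA EB : ℝ}
    (hC : ∀ ω θ, |a ω + b ω θ| ≤ C) (hC' : ∀ ω θ, |a' ω + b' ω θ| ≤ C')
    (ha : ∀ ω ω', (a ω - a' ω) + (a' ω' - a ω') ≤ EA)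
    (hb : ∀ ω ω' θ θ', (b ω θ - b' ω θ) + (b' ω' θ' - b ω' θ') ≤ EB)
    (hb' : ∀ ω θ, b' ω θ - b ω θ ≤ EB)
    {θ' : Θ} (hmin : ∀ θ, ⨆ ω, (a' ω + b' ω θ') ≤ ⨆ ω, (a' ω + b' ω θ)) :
    (⨆ ω, (a ω + b' ω θ')) - (⨅ θ, ⨆ ω, (a ω + b ω θ)) ≤ EA + EB ∧
    (⨆ ω, (a ω + b ω θ')) - (⨅ θ, ⨆ ω, (a ω + b ω θ)) ≤ EA + EB := by
  have hle : ∀ ω θ, a ω + b ω θ ≤ ⨆ ω, (a ω + b ω θ) := fun ω θ =>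
    le_ciSup (f := fun ω => a ω + b ω θ) (bddAbove_range_of_abs_le fun ω => hC ω θ) ω
  have hle' : ∀ ω θ, a' ω + b' ω θ ≤ ⨆ ω, (a' ω + b' ω θ) := fun ω θ =>
    le_ciSup (f := fun ω => a' ω + b' ω θ) (bddAbove_range_of_abs_le fun ω => hC' ω θ) ω
  -- Here `ω` stands for the competitor in the first supremum and `ω'` for the one in the empirical
  -- supremum at `θ`; minimality of `θ'` links the two. Deviations at two discriminators therefore
  -- occur together.
  have key : ∀ (c : Ω → ℝ) (D : ℝ),
      (∀ ω θ ω', c ω - (a' ω + b' ω θ') + (a' ω' + b' ω' θ - (a ω' + b ω' θ)) ≤ D) →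
      (⨆ ω, c ω) - (⨅ θ, ⨆ ω, (a ω + b ω θ)) ≤ D := by
    intro c D hD
    rw [sub_le_comm]
    refine le_ciInf fun θ => ?_
    rw [sub_le_iff_le_add]
    refine ciSup_le fun ω => ?_
    have h1 : ⨆ ω', (a' ω' + b' ω' θ) ≤ (⨆ ω, (a ω + b ω θ)) + D
        - (c ω - (a' ω + b' ω θ')) := by
      refine ciSup_le fun ω' => ?_
      linarith [hD ω θ ω', hle ω' θ]
    linarith [hle' ω θ', hmin θ]
  constructor
  -- At the empirical generated distribution the terms `b' ω θ'` cancel, and only the one-sided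
  -- deviation at `ω'` remains.
  · refine key _ _ fun ω θ ω' => ?_
    linarith [ha ω ω', hb' ω' θ]
  · refine key _ _ fun ω θ ω' => ?_
    linarith [ha ω ω', hb ω ω' θ' θ]

/-- A function which is Lipschitz on a symmetric interval agrees there, up to a constant, with a
bounded Lipschitz function vanishing at zero. -/
lemma exists_lipschitzWith_eq_add {g : ℝ → ℝ} {K : ℝ≥0} {Q : ℝ} (hQ : 0 ≤ Q)
    (hg : LipschitzOnWith K g (Set.Icc (-Q) Q)) :
    ∃ f : ℝ → ℝ, LipschitzWith K f ∧ f 0 = 0 ∧ (∀ t, |f t| ≤ K * Q) ∧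
      ∀ t, |t| ≤ Q → g t = g 0 + f t := by
  have hle : -Q ≤ Q := by linarith
  -- Clamping to the interval is `1`-Lipschitz and fixes its points.
  let p : ℝ → ℝ := fun t => Set.projIcc (-Q) Q hle t
  have hp : ∀ t, |t| ≤ Q → p t = t := fun t ht => by
    simp only [p, Set.projIcc_of_mem hle (abs_le.1 ht)]
  have hpm : ∀ t, p t ∈ Set.Icc (-Q) Q := fun t => (Set.projIcc (-Q) Q hle t).2
  have hp0 : p 0 = 0 := hp 0 (by simpa using hQ)
  refine ⟨fun t => g (p t) - g 0, ?_, by simp [hp0], fun t => ?_, fun t ht => ?_⟩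
  · refine LipschitzWith.of_dist_le_mul fun x y => ?_
    rw [dist_sub_right]
    refine (hg.dist_le_mul _ (hpm x) _ (hpm y)).trans ?_
    gcongr
    simpa [Subtype.dist_eq, p] using (LipschitzWith.projIcc hle).dist_le_mul x y
  · have h := hg.dist_le_mul _ (hpm t) _ (hpm 0)
    rw [hp0, Real.dist_eq, Real.dist_eq, sub_zero] at h
    exact h.trans (mul_le_mul_of_nonneg_left (abs_le.2 (hpm t)) (NNReal.coe_nonneg _))
  · simp only [hp t ht]; ring

/-! ### Regularity of networks in inputs and parameters -/

instance Matrix.instSecondCountableTopologyFin {m n : ℕ} :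
    SecondCountableTopology (Matrix (Fin m) (Fin n) ℝ) :=
  inferInstanceAs (SecondCountableTopology (Fin m → Fin n → ℝ))

lemma continuous_hiddenLayers {Y : Type*} [TopologicalSpace Y] (e : ℕ → ℕ) (a : ℕ → ℝ → ℝ) (j : ℕ)
    (ha : ∀ i ∈ Finset.Icc 1 j, Continuous (a i))
    {W : Y → (i : Fin j) → Matrix (Fin (e (i + 1))) (Fin (e i)) ℝ} (hW : Continuous W)
    {x : Y → Fin (e 0) → ℝ} (hx : Continuous x) :
    Continuous fun y => hiddenLayers e a j (W y) (x y) := by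
  induction j with
  | zero => exact hx
  | succ j ih =>
    have hsub : Finset.Icc 1 j ⊆ Finset.Icc 1 (j + 1) := Finset.Icc_subset_Icc_right (by omega)
    have h1 := ih (fun i hi => ha i (hsub hi)) (W := fun y i => W y i.castSucc)
      (continuous_pi fun i => (continuous_apply i.castSucc).comp hW)
    have h2 : Continuous fun y => W y (Fin.last j) := (continuous_apply (Fin.last j)).comp hW
    have h3 := h2.matrix_mulVec h1
    refine continuous_pi fun t => ?_
    exact (ha (j + 1) (by simp)).comp ((continuous_apply t).comp h3)

lemma continuous_logit {Y : Type*} [TopologicalSpace Y] {e : ℕ → ℕ} {r : ℕ → ℝ → ℝ} {k : ℕ}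
    (hr : ∀ i ∈ Finset.Icc 1 (k - 1), Continuous (r i))
    {ω : Y → DiscParam e k} (hω : Continuous ω)
    {x : Y → EuclideanSpace ℝ (Fin (e 0))} (hx : Continuous x) :
    Continuous fun y => logit e r k (ω y) (x y) := by
  have h1 := continuous_hiddenLayers e r (k - 1) hr (continuous_fst.comp hω)
    ((PiLp.continuous_ofLp 2 _).comp hx)
  have h2 : Continuous fun y => (ω y).2.ofLp :=
    (PiLp.continuous_ofLp 2 _).comp (continuous_snd.comp hω)
  exact continuous_finsetSum _ fun t _ =>
    ((continuous_apply t).comp h2).mul ((continuous_apply t).comp h1)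

lemma continuous_generator {Y : Type*} [TopologicalSpace Y] {q : ℕ → ℕ} {s : ℕ → ℝ → ℝ} {l d : ℕ}
    (hs : ∀ i ∈ Finset.Icc 1 (l - 1), Continuous (s i))
    {θ : Y → GenParam q l d} (hθ : Continuous θ)
    {z : Y → EuclideanSpace ℝ (Fin (q 0))} (hz : Continuous z) :
    Continuous fun y => generator q s l d (θ y) (z y) := by
  have h1 := continuous_hiddenLayers q s (l - 1) hs (continuous_fst.comp hθ)
    ((PiLp.continuous_ofLp 2 _).comp hz)
  exact (PiLp.continuous_toLp 2 _).comp ((continuous_snd.comp hθ).matrix_mulVec h1)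

lemma integral_empirical {E : Type*} [MeasurableSpace E] [MeasurableSingletonClass E] {n : ℕ}
    (x : Fin n → E) (f : E → ℝ) : ∫ y, f y ∂(empirical x) = (n : ℝ)⁻¹ * ∑ i, f (x i) := by
  rw [empirical, integral_smul_measure, integral_finsetSum_measure fun i _ => integrable_dirac
    (by simp)]
  simp

lemma logit_zero (e : ℕ → ℕ) (r : ℕ → ℝ → ℝ) (k : ℕ) (x : EuclideanSpace ℝ (Fin (e 0))) :
    logit e r k 0 x = 0 := by simp [logit]

open scoped Matrix.Norms.Frobenius in
lemma zero_mem_boundedDisc (e : ℕ → ℕ) (k : ℕ) (M : ℕ → ℝ≥0) : 0 ∈ boundedDisc e k M :=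
  ⟨fun i => by simp, by simp⟩

/-! ### Estimation error for losses Lipschitz in the logit -/

/-- The estimation error bound for a loss whose composition with the sigmoid is Lipschitz on the
range of the logits. -/
theorem estimationErrorLE_of_lipschitzOnWith_comp_sigmoid
    {S : Type*} [MeasurableSpace S] (μ : Measure S) [IsProbabilityMeasure μ]
    {k l : ℕ} (hk : 1 ≤ k) (hl : 1 ≤ l) (e q : ℕ → ℕ)
    (r s : ℕ → ℝ → ℝ) (R T M N : ℕ → ℝ≥0)
    (hrLip : ∀ i ∈ Finset.Icc 1 (k - 1), LipschitzWith (R i) (r i))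
    (hrHom : ∀ i ∈ Finset.Icc 1 (k - 1), ∀ c : ℝ, 0 ≤ c → ∀ p : ℝ, r i (c * p) = c * r i p)
    (hsLip : ∀ j ∈ Finset.Icc 1 (l - 1), LipschitzWith (T j) (s j))
    (hsHom : ∀ j ∈ Finset.Icc 1 (l - 1), ∀ c : ℝ, 0 ≤ c → ∀ p : ℝ, s j (c * p) = c * s j p)
    (Ω : Set (DiscParam e k)) (hΩne : Ω.Nonempty) (hΩ : Ω ⊆ boundedDisc e k M)
    (Θ : Set (GenParam q l (e 0))) (hΘne : Θ.Nonempty) (hΘ : Θ ⊆ boundedGen q l (e 0) N)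
    {Bx Bz : ℝ}
    (Pr : Measure (EuclideanSpace ℝ (Fin (e 0)))) [IsProbabilityMeasure Pr]
    (hPr : ∀ᵐ x ∂Pr, ‖x‖ ≤ Bx)
    (PZ : Measure (EuclideanSpace ℝ (Fin (q 0)))) [IsProbabilityMeasure PZ]
    (hPZ : ∀ᵐ z ∂PZ, ‖z‖ ≤ Bz)
    {n m : ℕ} (hn : 1 ≤ n) (hm : 1 ≤ m)
    (X : Fin n → S → EuclideanSpace ℝ (Fin (e 0))) (hX : ∀ i, Measurable (X i))
    (hXlaw : ∀ i, μ.map (X i) = Pr) (hXind : iIndepFun X μ)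
    (Z : Fin m → S → EuclideanSpace ℝ (Fin (q 0))) (hZ : ∀ j, Measurable (Z j))
    (hZlaw : ∀ j, μ.map (Z j) = PZ) (hZind : iIndepFun Z μ)
    {δ : ℝ} (hδ : 0 < δ) (hδ1 : δ < 1)
    (ℓ : Fin 2 → ℝ → ℝ) (K₁ K₀ : ℝ≥0)
    (h₁ : LipschitzOnWith K₁ (fun t => -ℓ 1 (Real.sigmoid t))
      (Set.Icc (-(capacity k M R * Bx)) (capacity k M R * Bx)))
    (h₀ : LipschitzOnWith K₀ (fun t => -ℓ 0 (Real.sigmoid t))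
      (Set.Icc (-(capacity k M R * capacity l N T * Bz)) (capacity k M R * capacity l N T * Bz))) :
    EstimationErrorLE μ r s k l n m Ω Θ ℓ Pr PZ X Z δ
      (errorBound k l n m Bx Bz (capacity k M R) (capacity l N T) (4 * K₁) (4 * K₀) δ) := by
  have hBx : 0 ≤ Bx := by
    obtain ⟨x, hx⟩ := hPr.exists
    exact (norm_nonneg x).trans hx
  have hBz : 0 ≤ Bz := by
    obtain ⟨x, hx⟩ := hPZ.exists
    exact (norm_nonneg x).trans hx
  have hU := capacity_nonneg k M R
  have hV := capacity_nonneg l N T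
  obtain ⟨g₁, hg₁, hg₁0, hg₁b, hg₁eq⟩ := exists_lipschitzWith_eq_add (by positivity) h₁
  obtain ⟨g₀, hg₀, hg₀0, hg₀b, hg₀eq⟩ := exists_lipschitzWith_eq_add (by positivity) h₀
  have hrc : ∀ i ∈ Finset.Icc 1 (k - 1), Continuous (r i) := fun i hi => (hrLip i hi).continuous
  have hsc : ∀ i ∈ Finset.Icc 1 (l - 1), Continuous (s i) := fun i hi => (hsLip i hi).continuous
  have hfc : ∀ ω : DiscParam e k, Continuous (logit e r k ω) := fun ω =>
    continuous_logit hrc continuous_const continuous_id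
  have hGc : ∀ θ : GenParam q l (e 0), Continuous (generator q s l (e 0) θ) := fun θ =>
    continuous_generator hsc continuous_const continuous_id
  -- Deviations are controlled over the full norm-bounded sets rather than `Ω` and `Θ`, because the
  -- zero discriminator, possibly outside `Ω`, is used below.
  have hnon : Nonempty (boundedDisc e k M) := ⟨⟨0, zero_mem_boundedDisc e k M⟩⟩
  have hnonG : Nonempty (boundedGen q l (e 0) N) := 
    ⟨⟨hΘne.some, hΘ hΘne.some_mem⟩⟩
  obtain ⟨A₁, hA₁, hA₁δ, hA₁dev⟩ := exists_measurableSet_forall_deviation_pair_le (μ := μ) (P := Pr)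
    (F := fun (ω : boundedDisc e k M) x => g₁ (logit e r k ω x)) (κ := √(3 * k))
    (fun ω => (hg₁.continuous.comp (hfc ω)).measurable)
    (fun x => hg₁.continuous.comp (continuous_logit hrc continuous_subtype_val continuous_const))
    (fun ω x => hg₁b _) hn hX hXlaw hXind (B := {x | ‖x‖ ≤ Bx}) hPr
    (fun x hx τ => sum_sign_comp_logit_le hn hk hrLip hrHom hg₁ hg₁0 hBx x hx τ) hδ hδ1
  obtain ⟨A₀, hA₀, hA₀δ, hA₀dev⟩ := exists_measurableSet_forall_deviation_pair_le (μ := μ) (P := PZ)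
    (F := fun (p : boundedDisc e k M × boundedGen q l (e 0) N) z =>
      g₀ (logit e r k p.1 (generator q s l (e 0) p.2 z))) (κ := √(3 * (k + l - 1)))
    (fun p => (hg₀.continuous.comp ((hfc p.1).comp (hGc p.2))).measurable)
    (fun z => hg₀.continuous.comp (continuous_logit hrc
      (continuous_subtype_val.comp continuous_fst)
      (continuous_generator hsc (continuous_subtype_val.comp continuous_snd) continuous_const)))
    (fun ω x => hg₀b _) hm hZ hZlaw hZind (B := {z | ‖z‖ ≤ Bz}) hPZ
    (fun z hz τ => sum_sign_comp_logit_generator_le hm hk hl hrLip hrHom hsLip hsHom hg₀ hg₀0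
      hBz z hz τ) hδ hδ1
  refine ⟨A₁ ∩ A₀, hA₁.inter hA₀, ?_, fun a ha θ' hθ' hmin => ?_⟩
  · have h := measureReal_union_le (μ := μ) A₁ᶜ A₀ᶜ
    rw [← Set.compl_inter, probReal_compl_eq_one_sub (hA₁.inter hA₀),
      probReal_compl_eq_one_sub hA₁, probReal_compl_eq_one_sub hA₀] at h
    linarith
  obtain ⟨hXa, hdev₁⟩ := hA₁dev a ha.1
  obtain ⟨hZa, hdev₀⟩ := hA₀dev a ha.2
  -- values of the loss on the logits
  have val₁ : ∀ (ω : Ω) (x : EuclideanSpace ℝ (Fin (e 0))), ‖x‖ ≤ Bx →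
      -ℓ 1 (discriminator e r k ω x) = -ℓ 1 (Real.sigmoid 0) + g₁ (logit e r k ω x) :=
    fun ω x hx => hg₁eq _ ((abs_logit_le hrLip hrHom (hΩ ω.2) x).trans (by gcongr))
  have val₀ : ∀ (ω : Ω) (x : EuclideanSpace ℝ (Fin (e 0))), ‖x‖ ≤ capacity l N T * Bz →
      -ℓ 0 (discriminator e r k ω x) = -ℓ 0 (Real.sigmoid 0) + g₀ (logit e r k ω x) :=
    fun ω x hx => hg₀eq _ ((abs_logit_le hrLip hrHom (hΩ ω.2) x).trans
      (by rw [mul_assoc]; gcongr))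
  have hGb : ∀ (θ : Θ) (z : EuclideanSpace ℝ (Fin (q 0))), ‖z‖ ≤ Bz →
      ‖generator q s l (e 0) θ z‖ ≤ capacity l N T * Bz := fun θ z hz =>
    (norm_generator_le hsLip hsHom (hΘ θ.2) z).trans (by gcongr)
  let c₁ := -ℓ 1 (Real.sigmoid 0)
  let c₀ := -ℓ 0 (Real.sigmoid 0)
  let u : Ω → ℝ := fun ω => c₁ + ∫ x, g₁ (logit e r k ω x) ∂Pr
  let u' : Ω → ℝ := fun ω => c₁ + (n : ℝ)⁻¹ * ∑ i, g₁ (logit e r k ω (X i a))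
  let v : Ω → Θ → ℝ := fun ω θ =>
    c₀ + ∫ z, g₀ (logit e r k ω (generator q s l (e 0) θ z)) ∂PZ
  let v' : Ω → Θ → ℝ := fun ω θ =>
    c₀ + (m : ℝ)⁻¹ * ∑ j, g₀ (logit e r k ω (generator q s l (e 0) θ (Z j a)))
  -- The loss is controlled only on the range of the logits. Each integral is evaluated through the
  -- clamped function, which agrees with it there up to a constant and supplies integrability.
  have eu : ∀ ω : Ω, ∫ x, -ℓ 1 (discriminator e r k ω x) ∂Pr = u ω := by
    intro ω
    have hi : Integrable (fun x => g₁ (logit e r k ω x)) Pr :=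
      integrable_of_abs_le (hg₁.continuous.comp (hfc ω)).measurable fun x => hg₁b _
    rw [integral_congr_ae (hPr.mono fun x hx => val₁ ω x hx),
      integral_add (integrable_const _) hi]
    simp [u, c₁]
  have eu' : ∀ ω : Ω, ∫ x, -ℓ 1 (discriminator e r k ω x) ∂(empirical fun i => X i a) = u' ω := by
    intro ω
    have hn' : (n : ℝ) ≠ 0 := by positivity
    rw [integral_empirical, Finset.sum_congr rfl fun i _ => val₁ ω _ (hXa i),
      Finset.sum_add_distrib, mul_add]
    simp [u', c₁, hn']
  have ev : ∀ (ω : Ω) (θ : Θ), ∫ x, -ℓ 0 (discriminator e r k ω x)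
      ∂(PZ.map (generator q s l (e 0) θ)) = v ω θ := by
    intro ω θ
    have hGm : AEMeasurable (generator q s l (e 0) θ) PZ := (hGc θ).measurable.aemeasurable
    have hi : Integrable (fun z => g₀ (logit e r k ω (generator q s l (e 0) θ z))) PZ :=
      integrable_of_abs_le (hg₀.continuous.comp ((hfc ω).comp (hGc θ))).measurable fun x => hg₀b _
    have hae : ∀ᵐ x ∂(PZ.map (generator q s l (e 0) θ)), ‖x‖ ≤ capacity l N T * Bz := by
      rw [ae_map_iff hGm (measurableSet_le measurable_norm measurable_const)]
      exact hPZ.mono fun z hz => hGb θ z hz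
    have hgm : Measurable fun x => -ℓ 0 (Real.sigmoid 0) + g₀ (logit e r k ω x) :=
      measurable_const.add (hg₀.continuous.comp (hfc ω)).measurable
    rw [integral_congr_ae (hae.mono fun x hx => val₀ ω x hx),
      integral_map hGm hgm.aestronglyMeasurable,
      integral_add (integrable_const _) hi]
    simp [v, c₀]
  have ev' : ∀ (ω : Ω) (θ : Θ), ∫ x, -ℓ 0 (discriminator e r k ω x)
      ∂(empirical fun j => generator q s l (e 0) θ (Z j a)) = v' ω θ := by
    intro ω θ
    have hm' : (m : ℝ) ≠ 0 := by positivity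
    rw [integral_empirical, Finset.sum_congr rfl fun j _ => val₀ ω _ (hGb θ _ (hZa j)),
      Finset.sum_add_distrib, mul_add]
    simp [v', c₀, hm']
  have absmean : ∀ (n : ℕ) (y : Fin n → ℝ) (C : ℝ), 0 ≤ C → (∀ i, |y i| ≤ C) →
      |(n : ℝ)⁻¹ * ∑ i, y i| ≤ C := by
    intro n y C hC hy
    rw [abs_mul, abs_of_nonneg (by positivity), inv_mul_eq_div]
    refine div_le_of_le_mul₀ (by positivity) hC ?_
    refine (Finset.abs_sum_le_sum_abs _ _).trans ((Finset.sum_le_sum fun i _ => hy i).trans_eq ?_)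
    simp [mul_comm]
  have : Nonempty Ω := hΩne.to_subtype
  have : Nonempty Θ := hΘne.to_subtype
  let emb : Ω → boundedDisc e k M := fun ω => ⟨ω, hΩ ω.2⟩
  let embG : Θ → boundedGen q l (e 0) N := fun θ => ⟨θ, hΘ θ.2⟩
  have main := iSup_sub_iInf_iSup_le_of_minimizer (a := u) (a' := u') (b := v) (b' := v')
    (C := (|c₁| + K₁ * (capacity k M R * Bx))
      + (|c₀| + K₀ * (capacity k M R * capacity l N T * Bz)))
    (C' := (|c₁| + K₁ * (capacity k M R * Bx))
      + (|c₀| + K₀ * (capacity k M R * capacity l N T * Bz)))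
    (EA := 4 * (K₁ * (capacity k M R * Bx)) * √(3 * k) / √n + √(Real.log (1 / δ))
      * (4 * (K₁ * (capacity k M R * Bx)) / √(2 * n)))
    (EB := 4 * (K₀ * (capacity k M R * capacity l N T * Bz)) * √(3 * (k + l - 1)) / √m
      + √(Real.log (1 / δ)) * (4 * (K₀ * (capacity k M R * capacity l N T * Bz)) / √(2 * m)))
    (fun ω θ => (abs_add_le _ _).trans (add_le_add
      ((abs_add_le _ _).trans (add_le_add le_rfl (abs_integral_le_of_abs_le fun x => hg₁b _)))
      ((abs_add_le _ _).trans (add_le_add le_rfl (abs_integral_le_of_abs_le fun x => hg₀b _)))))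
    (fun ω θ => (abs_add_le _ _).trans (add_le_add
      ((abs_add_le _ _).trans (add_le_add le_rfl
        (absmean n _ _ (by positivity) fun x => hg₁b _)))
      ((abs_add_le _ _).trans (add_le_add le_rfl
        (absmean m _ _ (by positivity) fun x => hg₀b _)))))
    (fun ω ω' => by
      have := hdev₁ (emb ω) (emb ω')
      simp only [u, u']
      simp only [emb] at this
      linarith)
    (fun ω ω' θ θ' => by
      have := hdev₀ (emb ω, embG θ) (emb ω', embG θ')
      simp only [v, v']
      simp only [emb, embG] at this
      linarith)
    -- A single deviation is a difference of two: the zero discriminator has logit zero, and `g₀ 0 =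
    -- 0`, so its deviation vanishes.
    (fun ω θ => by
      have := hdev₀ (⟨0, zero_mem_boundedDisc e k M⟩, embG θ) (emb ω, embG θ)
      simp only [v, v']
      simp only [emb, embG, logit_zero, hg₀0, integral_zero, Finset.sum_const_zero] at this
      linarith)
    (θ' := ⟨θ', hθ'⟩)
    (fun θ => by
      have := hmin θ.2
      simp only [Set.mem_ofPred_eq, nnDist] at this
      simpa only [eu', ev' _ ⟨θ', hθ'⟩, ev' _ θ] using this)
  have hbound : errorBound k l n m Bx Bz (capacity k M R) (capacity l N T) (4 * K₁) (4 * K₀) δ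
      = (4 * (K₁ * (capacity k M R * Bx)) * √(3 * k) / √n + √(Real.log (1 / δ))
          * (4 * (K₁ * (capacity k M R * Bx)) / √(2 * n)))
        + (4 * (K₀ * (capacity k M R * capacity l N T * Bz)) * √(3 * (k + l - 1)) / √m
          + √(Real.log (1 / δ))
            * (4 * (K₀ * (capacity k M R * capacity l N T * Bz)) / √(2 * m))) := by
    rw [errorBound]
    ring
  rw [hbound]
  simp only [nnDist]
  have evθ' := fun ω => ev ω ⟨θ', hθ'⟩
  have evθ'' := fun ω => ev' ω ⟨θ', hθ'⟩
  simp only at evθ' evθ''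
  simp only [eu, ev, evθ', evθ'']
  exact main

/-! ### Lipschitz constants of losses composed with the sigmoid -/

lemma lipschitzWith_sigmoid : LipschitzWith (1 / 4) Real.sigmoid := by
  refine lipschitzWith_of_nnnorm_deriv_le
    (fun x => (Real.hasDerivAt_sigmoid x).differentiableAt) fun x => ?_
  rw [← NNReal.coe_le_coe, coe_nnnorm, Real.deriv_sigmoid, Real.norm_eq_abs, abs_of_nonneg
    (mul_nonneg (Real.sigmoid_nonneg _) (by linarith [Real.sigmoid_le_one x]))]
  push_cast
  nlinarith [sq_nonneg (Real.sigmoid x - 1 / 2)]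

lemma alphaLoss_zero_eq (α p : ℝ) : alphaLoss α 0 p = alphaLoss α 1 (1 - p) := by
  simp [alphaLoss]

/-- The factor `α / (α - 1)` cancels the exponent, so one formula covers `α = 1` as well. -/
lemma hasDerivAt_neg_alphaLoss_one_sigmoid {α : ℝ} (hα : 0 < α) (t : ℝ) :
    HasDerivAt (fun t => -alphaLoss α 1 (Real.sigmoid t))
      ((1 - Real.sigmoid t) * Real.sigmoid t ^ ((α - 1) / α)) t := by
  have hσ := Real.sigmoid_pos t
  have hd := Real.hasDerivAt_sigmoid t
  rcases eq_or_ne α 1 with rfl | h1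
  · have e : (fun t => -alphaLoss 1 1 (Real.sigmoid t)) = fun t => Real.log (Real.sigmoid t) := by
      funext t; simp [alphaLoss]
    rw [e]
    refine (hd.log hσ.ne').congr_deriv ?_
    rw [mul_div_cancel_left₀ _ hσ.ne']
    simp
  · have e : (fun t => -alphaLoss α 1 (Real.sigmoid t))
        = fun t => -(α / (α - 1) * (1 - Real.sigmoid t ^ ((α - 1) / α))) := by
      funext t; simp [alphaLoss, h1]
    rw [e]
    refine (((hd.rpow_const (p := (α - 1) / α) (Or.inl hσ.ne')).const_sub 1).const_mul
      (α / (α - 1))).fun_neg.congr_deriv ?_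
    have h4 : α - 1 ≠ 0 := sub_ne_zero.2 h1
    rw [Real.rpow_sub_one hσ.ne']
    field_simp

lemma alphaLipConst_nonneg {α : ℝ} (h : ℝ) (hα : 0 < α) : 0 ≤ alphaLipConst h α := by
  rw [alphaLipConst]
  split_ifs with h1
  · exact mul_nonneg (Real.sigmoid_nonneg _) (Real.rpow_nonneg (Real.sigmoid_nonneg _) _)
  · have : 0 < α - 1 := by linarith
    have : 0 < 2 * α - 1 := by linarith
    positivity

/-- Weighted AM–GM with weights `1 / (1 + β)` and `β / (1 + β)` on `1 - p` and `p / β`; equality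
holds at `p = β / (1 + β)`. -/
lemma one_sub_mul_rpow_le {β p : ℝ} (hβ : 0 < β) (hp : 0 ≤ p) (hp1 : p ≤ 1) :
    (1 - p) * p ^ β ≤ (β / (1 + β)) ^ β * (1 / (1 + β)) := by
  have h := Real.geom_mean_le_arith_mean2_weighted (w₁ := 1 / (1 + β)) (w₂ := β / (1 + β))
    (p₁ := 1 - p) (p₂ := p / β) (by positivity) (by positivity) (by linarith) (by positivity)
    (by field_simp)
  have e1 : 1 / (1 + β) * (1 - p) + β / (1 + β) * (p / β) = 1 / (1 + β) := by
    field_simp; ring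
  rw [e1] at h
  have h2 := Real.rpow_le_rpow (by
    have : 0 ≤ 1 - p := by linarith
    positivity) h (by positivity : 0 ≤ 1 + β)
  have h1p : 0 ≤ 1 - p := by linarith
  rw [Real.mul_rpow (by positivity) (by positivity), ← Real.rpow_mul h1p,
    ← Real.rpow_mul (by positivity), one_div_mul_cancel (by positivity),
    div_mul_cancel₀ _ (by positivity), Real.rpow_one, Real.div_rpow hp hβ.le] at h2
  have hβ' : 0 < β ^ β := Real.rpow_pos_of_pos hβ _
  rw [Real.div_rpow hβ.le (by positivity)]
  calc (1 - p) * p ^ β = β ^ β * ((1 - p) * (p ^ β / β ^ β)) := by field_simp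
    _ ≤ β ^ β * (1 / (1 + β)) ^ (1 + β) := by gcongr
    _ = _ := by
      rw [Real.rpow_add (by positivity), Real.rpow_one, Real.div_rpow zero_le_one (by positivity),
        Real.one_rpow]
      ring

/-- For `α ≤ 1` the exponent is nonpositive, so both factors decrease in `t` and the maximum is at
`t = -h`. For `α > 1` the maximum over all `p ∈ [0, 1]` is used, which does not depend on `h`. -/
lemma one_sub_sigmoid_mul_rpow_le_alphaLipConst {α : ℝ} (hα : 0 < α) {h t : ℝ} (ht : |t| ≤ h) :
    (1 - Real.sigmoid t) * Real.sigmoid t ^ ((α - 1) / α) ≤ alphaLipConst h α := by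
  rw [alphaLipConst]
  split_ifs with h1
  · rw [← Real.sigmoid_neg]
    have := abs_le.1 ht
    refine mul_le_mul (Real.sigmoid_le (by linarith)) ?_
      (Real.rpow_nonneg (Real.sigmoid_nonneg _) _) (Real.sigmoid_nonneg _)
    exact Real.rpow_le_rpow_of_nonpos (Real.sigmoid_pos _) (Real.sigmoid_le this.1)
      (div_nonpos_of_nonpos_of_nonneg (by linarith) hα.le)
  · have hα1 : 0 < α - 1 := by linarith
    have hα2 : 0 < 2 * α - 1 := by linarith
    have := one_sub_mul_rpow_le (β := (α - 1) / α) (by positivity) (Real.sigmoid_nonneg t)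
      (Real.sigmoid_le_one t)
    have e1 : (1 : ℝ) + (α - 1) / α = (2 * α - 1) / α := by field_simp; ring
    rw [e1] at this
    convert this using 2
    · congr 1
      field_simp
    · field_simp

lemma lipschitzOnWith_neg_alphaLoss_one_sigmoid {α : ℝ} (hα : 0 < α) (h : ℝ) :
    LipschitzOnWith (alphaLipConst h α).toNNReal (fun t => -alphaLoss α 1 (Real.sigmoid t))
      (Set.Icc (-h) h) := by
  refine (convex_Icc _ _).lipschitzOnWith_of_nnnorm_hasDerivWithin_le
    (fun t _ => (hasDerivAt_neg_alphaLoss_one_sigmoid hα t).hasDerivWithinAt) fun t ht => ?_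
  rw [← NNReal.coe_le_coe, Real.coe_toNNReal _ (alphaLipConst_nonneg h hα), coe_nnnorm,
    Real.norm_eq_abs, abs_of_nonneg (mul_nonneg (by linarith [Real.sigmoid_le_one t])
      (Real.rpow_nonneg (Real.sigmoid_nonneg _) _))]
  exact one_sub_sigmoid_mul_rpow_le_alphaLipConst hα (abs_le.2 ht)

lemma lipschitzOnWith_neg_alphaLoss_zero_sigmoid {α : ℝ} (hα : 0 < α) (h : ℝ) :
    LipschitzOnWith (alphaLipConst h α).toNNReal (fun t => -alphaLoss α 0 (Real.sigmoid t))
      (Set.Icc (-h) h) := by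
  refine LipschitzOnWith.of_dist_le_mul fun x hx y hy => ?_
  -- Since `1 - σ(t) = σ(-t)`, the loss for label `0` is the reflection of the loss for label `1`.
  have := (lipschitzOnWith_neg_alphaLoss_one_sigmoid hα h).dist_le_mul (-x)
    ⟨neg_le_neg hx.2, by linarith [hx.1]⟩ (-y) ⟨neg_le_neg hy.2, by linarith [hy.1]⟩
  simpa only [alphaLoss_zero_eq, ← Real.sigmoid_neg, dist_neg_neg] using this

/-! ### The two cases of the theorem -/

theorem theorem3 {S : Type*} [MeasurableSpace S] (μ : Measure S) [IsProbabilityMeasure μ]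
    -- architecture: numbers of layers, widths, activations, norm bounds
    (k l : ℕ) (hk : 1 ≤ k) (hl : 1 ≤ l) (e q : ℕ → ℕ)
    (r s : ℕ → ℝ → ℝ) (R T M N : ℕ → ℝ≥0)
    (hrLip : ∀ i ∈ Finset.Icc 1 (k - 1), LipschitzWith (R i) (r i))
    (hrHom : ∀ i ∈ Finset.Icc 1 (k - 1), ∀ c : ℝ, 0 ≤ c → ∀ p : ℝ, r i (c * p) = c * r i p)
    (hsLip : ∀ j ∈ Finset.Icc 1 (l - 1), LipschitzWith (T j) (s j))
    (hsHom : ∀ j ∈ Finset.Icc 1 (l - 1), ∀ c : ℝ, 0 ≤ c → ∀ p : ℝ, s j (c * p) = c * s j p)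
    (Ω : Set (DiscParam e k)) (hΩne : Ω.Nonempty) (hΩ : Ω ⊆ boundedDisc e k M)
    (Θ : Set (GenParam q l (e 0))) (hΘne : Θ.Nonempty) (hΘ : Θ ⊆ boundedGen q l (e 0) N)
    -- real and noise distributions, supported in balls
    (Bx Bz : ℝ)
    (Pr : Measure (EuclideanSpace ℝ (Fin (e 0)))) [IsProbabilityMeasure Pr]
    (hPr : ∀ᵐ x ∂Pr, ‖x‖ ≤ Bx)
    (PZ : Measure (EuclideanSpace ℝ (Fin (q 0)))) [IsProbabilityMeasure PZ]
    (hPZ : ∀ᵐ z ∂PZ, ‖z‖ ≤ Bz)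
    -- i.i.d. training samples
    (n m : ℕ) (hn : 1 ≤ n) (hm : 1 ≤ m)
    (X : Fin n → S → EuclideanSpace ℝ (Fin (e 0))) (hX : ∀ i, Measurable (X i))
    (hXlaw : ∀ i, μ.map (X i) = Pr) (hXind : iIndepFun X μ)
    (Z : Fin m → S → EuclideanSpace ℝ (Fin (q 0))) (hZ : ∀ j, Measurable (Z j))
    (hZlaw : ∀ j, μ.map (Z j) = PZ) (hZind : iIndepFun Z μ)
    (δ : ℝ) (hδ : 0 < δ) (hδ1 : δ < 1) :
    -- general CPE loss
    (∀ (ℓ : Fin 2 → ℝ → ℝ) (Lφ Lψ : ℝ≥0),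
      LipschitzOnWith Lφ (fun p => -ℓ 1 p) (Set.Icc 0 1) →
      LipschitzOnWith Lψ (fun p => -ℓ 0 p) (Set.Icc 0 1) →
      EstimationErrorLE μ r s k l n m Ω Θ ℓ Pr PZ X Z δ
        (errorBound k l n m Bx Bz (capacity k M R) (capacity l N T) Lφ Lψ δ)) ∧
    -- the α-loss
    (∀ α : ℝ, 0 < α →
      EstimationErrorLE μ r s k l n m Ω Θ (alphaLoss α) Pr PZ X Z δ
        (errorBound k l n m Bx Bz (capacity k M R) (capacity l N T)
          (4 * alphaLipConst (capacity k M R * Bx) α)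
          (4 * alphaLipConst (capacity k M R * capacity l N T * Bz) α) δ)) := by
  -- The Lipschitz constant `1/4` of the sigmoid cancels the factor `4` of the general bound; for
  -- the `α`-loss the composition is estimated directly and the `4` stays.
  have hq : ∀ L : ℝ≥0, (L : ℝ) = 4 * ((L * (1 / 4) : ℝ≥0) : ℝ) := fun L => by
    push_cast
    ring
  have hmaps : ∀ Q : ℝ, Set.MapsTo Real.sigmoid (Set.Icc (-Q) Q) (Set.Icc 0 1) := fun Q t _ =>
    ⟨Real.sigmoid_nonneg t, Real.sigmoid_le_one t⟩
  refine ⟨fun ℓ Lφ Lψ hφ hψ => ?_, fun α hα => ?_⟩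
  · rw [hq Lφ, hq Lψ]
    exact estimationErrorLE_of_lipschitzOnWith_comp_sigmoid μ hk hl e q r s R T M N hrLip hrHom
      hsLip hsHom Ω hΩne hΩ Θ hΘne hΘ Pr hPr PZ hPZ hn hm X hX hXlaw hXind Z hZ hZlaw hZind
      hδ hδ1 ℓ _ _ (hφ.comp lipschitzWith_sigmoid.lipschitzOnWith (hmaps _))
      (hψ.comp lipschitzWith_sigmoid.lipschitzOnWith (hmaps _))
  · rw [← Real.coe_toNNReal _ (alphaLipConst_nonneg (capacity k M R * Bx) hα),
      ← Real.coe_toNNReal _ (alphaLipConst_nonneg (capacity k M R * capacity l N T * Bz) hα)]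
    exact estimationErrorLE_of_lipschitzOnWith_comp_sigmoid μ hk hl e q r s R T M N hrLip hrHom
      hsLip hsHom Ω hΩne hΩ Θ hΘne hΘ Pr hPr PZ hPZ hn hm X hX hXlaw hXind Z hZ hZlaw hZind
      hδ hδ1 (alphaLoss α) _ _ (lipschitzOnWith_neg_alphaLoss_one_sigmoid hα _)
      (lipschitzOnWith_neg_alphaLoss_zero_sigmoid hα _)
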